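/- Let $p,n\ge 0$ be integers and $E=\{1,\dots,p\}$. The standard Clifford algebra $\mathcal{C}l(E)$ is the real algebra with basis $(\omega_A)_{A\subseteq E}$ and product $\omega_A\omega_B=(A|B)\,\omega_{A\Delta B}$, where $(A|B)=\prod_{i\in A,\,j\in B}(i|j)$, $(i|j)=1$ if $i<j$ and $(i|j)=-1$ if $j\le i$. For a family $M=(M^A)_{A\subseteq E}$ of real $n\times n$ matrices, let $\mathcal M$ be the real $(n2^p)\times(n2^p)$ matrix of left multiplication by $\sum_A M^A\omega_A$ on $\mathbb{R}^n\otimes\mathcal{C}l(E)$, whose $(A,B)$ block is $(A\Delta B|B)\,M^{A\Delta B}$. The family is called $\mathcal{C}l(E)$-symmetric if $\mathcal M$ is symmetric, that is, if $(M^A)^t=(A|A)M^A$ for every $A$. The $\mathcal{C}l(E)$-symmetric families form a Euclidean space $V$ with the norm $\|M\|^2=\sum_{A,i,j}(M^A_{ij})^2$. Let $\mathrm L$ be the Laplace operator of $V$ and let $\Gamma(f,g)=\frac12\big(\mathrm L(fg)-f\mathrm L(g)-g\mathrm L(f)\big)$; thus $\mathrm L(M^A_{ij})=0$ and $\Gamma(M^A_{ij},M^B_{kl})=\frac12\delta_{A,B}\big(\delta_{ik}\delta_{jl}+(A|A)\delta_{il}\delta_{jk}\big)$.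 Put $P(X)=\det(\mathcal M-X\,\mathrm{Id})$ and $U(X)=(\mathcal M-X\,\mathrm{Id})^{-1}$. For fixed real $X$, $P(X)$ is a function on $V$; primes denote derivatives in $X$. The following hold at every point of $V$. 1. For all real $X\ne Y$, $$\Gamma(P(X),P(Y))=\frac{2^p}{Y-X}\big(P'(X)P(Y)-P'(Y)P(X)\big).$$ 2. Let $p$ be even and $P(X)\neq0$, and write $\Gamma(\log P)=\Gamma(\log |P(X)|,\log |P(X)|)$. If $p=4m+2$, then $$\frac{\mathrm L(P)}{P}=\Gamma(\log P)-2^{2m}(-1)^{m+1}\,\mathrm{trace}\big(U(X)^2\big)-\tfrac12\big(\mathrm{trace}\,U(X)\big)^2=\big(2^p+2^{2m}(-1)^m\big)\Big(\frac{P'^2}{P^2}-\frac{P''}{P}\Big)-\frac12\frac{P'^2}{P^2}.$$ If $p=4m$, then $$\frac{\mathrm L(P)}{P}=\Gamma(\log P)-2^{2m-1}(-1)^{m}\,\mathrm{trace}\big(U(X)^2\big)-\tfrac12\big(\mathrm{trace}\,U(X)\big)^2=\big(2^p+2^{2m-1}(-1)^{m+1}\big)\Big(\frac{P'^2}{P^2}-\frac{P''}{P}\Big)-\frac12\frac{P'^2}{P^2}.$$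 3. Let $p$ be even, and let $a=2^{4q},\,2^{4q+2},\,2^{4q+3},\,2^{4q+3}$ when $p=8q,\,8q+2,\,8q+4,\,8q+6$ respectively. Then there is a polynomial $Q(X)$, whose coefficients are polynomials in the entries of $M$, such that $P(X)=Q(X)^a$ for every $M\in V$. 4. Let $p$ and $a$ be as in 3, put $\hat{\mathrm L}=\frac{a}{2^p}\mathrm L$, and let $\hat\Gamma$ be obtained from $\hat{\mathrm L}$ as $\Gamma$ is from $\mathrm L$. For every family of real polynomials $Q=Q_M$ $(M\in V)$ whose coefficients are $C^2$ functions on $V$ and which satisfies $P=Q^a$, one has, for all real $X\neq Y$, $$\hat\Gamma(Q(X),Q(Y))=\frac1{Y-X}\big(Q'(X)Q(Y)-Q'(Y)Q(X)\big),$$ and, for every real $X$, $\hat{\mathrm L}(Q)=-\frac12Q''$ if $p=8q$ or $p=8q+6$ (real case), and $\hat{\mathrm L}(Q)=-2Q''$ if $p=8q+2$ or $p=8q+4$ (quaternionic case). -/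

import Mathlib

open Polynomial

/-- The sign `(i|j)` of the standard Clifford algebra on `E = {1, …, p}`:
`(i|j) = 1` if `i < j` and `(i|j) = -1` if `j ≤ i`. -/
def genSign {p : ℕ} (i j : Fin p) : ℝ := if i < j then 1 else -1

/-- The sign `(A|B) = ∏_{i ∈ A, j ∈ B} (i|j)`. The standard Clifford algebra `Cl(E)` is the real
vector space with basis `ω_A`, `A ⊆ E`, and product `ω_A ω_B = (A|B) ω_{A ∆ B}`. -/
def clSign {p : ℕ} (A B : Finset (Fin p)) : ℝ := ∏ i ∈ A, ∏ j ∈ B, genSign i j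

theorem genSign_mul_self {p : ℕ} (i j : Fin p) : genSign i j * genSign i j = 1 := by
  unfold genSign; split_ifs <;> norm_num

/-- `ω_∅` is a left unit. -/
theorem clSign_empty_left {p : ℕ} (B : Finset (Fin p)) : clSign ∅ B = 1 := by
  simp [clSign]

/-- `ω_∅` is a right unit. -/
theorem clSign_empty_right {p : ℕ} (A : Finset (Fin p)) : clSign A ∅ = 1 := by
  simp [clSign]

/-- The generators square to `-1`. -/
theorem clSign_generator_self {p : ℕ} (i : Fin p) : clSign {i} {i} = -1 := by
  simp [clSign, genSign]

/-- Distinct generators anticommute. -/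
theorem clSign_generator_anticomm {p : ℕ} {i j : Fin p} (h : i ≠ j) :
    clSign {i} {j} * clSign {j} {i} = -1 := by
  rcases lt_or_gt_of_ne h with h | h <;> simp [clSign, genSign, h, h.le, not_lt]

/-- A product of signs over a symmetric difference. -/
theorem prod_symmDiff_of_sign {ι : Type*} [DecidableEq ι] (f : ι → ℝ) (hf : ∀ i, f i * f i = 1)
    (A B : Finset ι) :
    ∏ i ∈ symmDiff A B, f i = (∏ i ∈ A, f i) * ∏ i ∈ B, f i := by
  have hA := Finset.prod_sdiff (f := f) (Finset.inter_subset_left : A ∩ B ⊆ A)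
  have hB := Finset.prod_sdiff (f := f) (Finset.inter_subset_right : A ∩ B ⊆ B)
  have hI : (∏ i ∈ A ∩ B, f i) * ∏ i ∈ A ∩ B, f i = 1 := by
    rw [← Finset.prod_mul_distrib]; exact Finset.prod_eq_one fun i _ => hf i
  rw [Finset.sdiff_inter_self_left] at hA
  rw [Finset.sdiff_inter_self_right] at hB
  have hd : ∏ i ∈ symmDiff A B, f i = (∏ i ∈ A \ B, f i) * ∏ i ∈ B \ A, f i := by
    rw [symmDiff_def, Finset.sup_eq_union, Finset.prod_union]
    exact disjoint_sdiff_sdiff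
  rw [hd, ← hA, ← hB]
  linear_combination (-(∏ i ∈ A \ B, f i) * ∏ i ∈ B \ A, f i) * hI

theorem clSign_symmDiff_left {p : ℕ} (A B C : Finset (Fin p)) :
    clSign (symmDiff A B) C = clSign A C * clSign B C := by
  unfold clSign
  refine prod_symmDiff_of_sign _ (fun i => ?_) A B
  rw [← Finset.prod_mul_distrib]
  exact Finset.prod_eq_one fun j _ => genSign_mul_self i j

theorem clSign_symmDiff_right {p : ℕ} (A B C : Finset (Fin p)) :
    clSign A (symmDiff B C) = clSign A B * clSign A C := by
  unfold clSign
  rw [← Finset.prod_mul_distrib]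
  exact Finset.prod_congr rfl fun i _ => prod_symmDiff_of_sign _ (genSign_mul_self i) B C

/-- Associativity of the product `ω_A ω_B = (A|B) ω_{A ∆ B}`. -/
theorem clSign_assoc {p : ℕ} (A B C : Finset (Fin p)) :
    clSign A (symmDiff B C) * clSign B C = clSign A B * clSign (symmDiff A B) C := by
  rw [clSign_symmDiff_left, clSign_symmDiff_right]; ring

theorem clSign_mul_self {p : ℕ} (A B : Finset (Fin p)) : clSign A B * clSign A B = 1 := by
  rw [← clSign_symmDiff_right, symmDiff_self]
  exact clSign_empty_right A

/-- Families `(M^A_{ij})`, that is, `n × n` matrices `∑_A M^A ω_A` with entries in `Cl(E)`, with the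
Euclidean metric for which the `ω_A` are orthonormal: `‖M‖² = ∑_{A,i,j} (M^A_{ij})²`. -/
abbrev ClMatrix (p n : ℕ) : Type :=
  EuclideanSpace ℝ (Finset (Fin p) × Fin n × Fin n)

/-- The component `M^A`, an `n × n` real matrix. -/
def ClMatrix.comp {p n : ℕ} (M : ClMatrix p n) (A : Finset (Fin p)) : Matrix (Fin n) (Fin n) ℝ :=
  Matrix.of fun i j => M (A, i, j)

/-- The real block matrix of the action of `∑_A M^A ω_A` by left multiplication on `ℝⁿ ⊗ Cl(E)`:
its `(A, B)` block is `(A ∆ B|B) M^{A ∆ B}`. -/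
noncomputable def ClMatrix.block {p n : ℕ} (M : ClMatrix p n) :
    Matrix (Finset (Fin p) × Fin n) (Finset (Fin p) × Fin n) ℝ :=
  Matrix.of fun r c =>
    clSign (symmDiff r.1 c.1) c.1 * M.comp (symmDiff r.1 c.1) r.2 c.2

/-- The block matrix acts by `(∑_C M^C ω_C)(∑_B x^B ω_B) = ∑_{C,B} (C|B) M^C x^B ω_{C ∆ B}`. -/
theorem ClMatrix.block_mulVec {p n : ℕ} (M : ClMatrix p n) (x : Finset (Fin p) × Fin n → ℝ)
    (A : Finset (Fin p)) (i : Fin n) :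
    M.block.mulVec x (A, i) = ∑ C : Finset (Fin p), ∑ B : Finset (Fin p),
      if symmDiff C B = A then clSign C B * ∑ j, M.comp C i j * x (B, j) else 0 := by
  rw [Finset.sum_comm]
  simp only [Matrix.mulVec, dotProduct, Fintype.sum_prod_type]
  refine Finset.sum_congr rfl fun B _ => ?_
  rw [Finset.sum_eq_single (symmDiff A B)]
  · simp [ClMatrix.block, Finset.mul_sum, mul_assoc]
  · intro C _ hC
    rw [if_neg]
    rintro rfl
    exact hC (by simp)
  · simp

/-- The Euclidean space of `Cl(E)`-symmetric matrices: those `∑_A M^A ω_A` whose real block matrix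
is symmetric. -/
def ClSymm (p n : ℕ) : Submodule ℝ (ClMatrix p n) where
  carrier := {M | M.block.IsSymm}
  zero_mem' := by
    ext r c; simp [ClMatrix.block, ClMatrix.comp]
  add_mem' := by
    intro M N hM hN
    have h : (M + N).block = M.block + N.block := by
      ext r c; simp [ClMatrix.block, ClMatrix.comp, mul_add]
    change (M + N).block.IsSymm
    rw [h]; exact Matrix.IsSymm.add hM hN
  smul_mem' := by
    intro t M hM
    have h : (t • M).block = t • M.block := by
      ext r c; simp [ClMatrix.block, ClMatrix.comp]; ring
    change (t • M).block.IsSymm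
    rw [h]; exact Matrix.IsSymm.smul hM t

/-- `Cl(E)`-symmetry means `(M^A)ᵗ = (A|A) M^A` for every `A`. -/
theorem mem_clSymm_iff {p n : ℕ} (M : ClMatrix p n) :
    M ∈ ClSymm p n ↔ ∀ A i j, M (A, j, i) = clSign A A * M (A, i, j) := by
  change M.block.IsSymm ↔ _
  constructor
  · intro h A i j
    have := h.apply (A, i) (∅, j)
    simp only [ClMatrix.block, ClMatrix.comp, Matrix.of_apply, Finset.bot_eq_empty.symm,
      symmDiff_bot, bot_symmDiff] at this
    rw [Finset.bot_eq_empty, clSign_empty_right] at this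
    linear_combination clSign A A * this - M (A, j, i) * clSign_mul_self A A
  · intro h
    refine Matrix.IsSymm.ext fun r c => ?_
    simp only [ClMatrix.block, ClMatrix.comp, Matrix.of_apply]
    rw [symmDiff_comm c.1 r.1, h (symmDiff r.1 c.1) r.2 c.2]
    have e : clSign (symmDiff r.1 c.1) (symmDiff r.1 c.1)
        = clSign (symmDiff r.1 c.1) r.1 * clSign (symmDiff r.1 c.1) c.1 :=
      clSign_symmDiff_right _ _ _
    rw [e]
    linear_combination (clSign (symmDiff r.1 c.1) c.1 * M (symmDiff r.1 c.1, r.2, c.2)) *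
      clSign_mul_self (symmDiff r.1 c.1) r.1

/-- The polynomial `P(X) = det(𝓜 - X Id)` of the block matrix `𝓜` of `M`. -/
noncomputable def detPoly {p n : ℕ} (M : ClSymm p n) : ℝ[X] :=
  ((M : ClMatrix p n).block.map C - (X : ℝ[X]) • 1).det

/-- The resolvent `U(x) = (𝓜 - x Id)⁻¹`. -/
noncomputable def clResolvent {p n : ℕ} (M : ClSymm p n) (x : ℝ) :
    Matrix (Finset (Fin p) × Fin n) (Finset (Fin p) × Fin n) ℝ :=
  ((M : ClMatrix p n).block - x • 1)⁻¹

/-- The carré du champ `Γ(f, g) = (L(fg) - f L(g) - g L(f)) / 2` of an operator `L`. -/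
noncomputable def carreDuChamp {V : Type*} (L : (V → ℝ) → V → ℝ) (f g : V → ℝ) (x : V) : ℝ :=
  (L (fun y => f y * g y) x - f x * L g x - g x * L f x) / 2

/-- The Euclidean Laplace operator on `Cl(E)`-symmetric matrices. -/
noncomputable def clLaplacian (p n : ℕ) (f : ClSymm p n → ℝ) : ClSymm p n → ℝ :=
  Laplacian.laplacian f

/-- The coordinate function `M ↦ M^A_{ij}`. -/
noncomputable def clCoord {p n : ℕ} (A : Finset (Fin p)) (i j : Fin n) : ClSymm p n →L[ℝ] ℝ :=
  (EuclideanSpace.proj (A, i, j) : ClMatrix p n →L[ℝ] ℝ).comp (ClSymm p n).subtypeL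

theorem clLaplacian_linear {p n : ℕ} (l : ClSymm p n →L[ℝ] ℝ) (M : ClSymm p n) :
    clLaplacian p n l M = 0 := by
  have h : fderiv ℝ (l : ClSymm p n → ℝ) = fun _ => l := by ext x; simp
  unfold clLaplacian
  rw [InnerProductSpace.laplacian_eq_iteratedFDeriv_stdOrthonormalBasis]
  simp [iteratedFDeriv_two_apply, h]

/-- The Laplace operator has `L(M^A_{ij}) = 0`. -/
theorem clLaplacian_coord {p n : ℕ} (A : Finset (Fin p)) (i j : Fin n) (M : ClSymm p n) :
    clLaplacian p n (clCoord A i j) M = 0 :=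
  clLaplacian_linear _ M

theorem ite_and_mul_ite (a b : Prop) [Decidable a] [Decidable b] :
    (if a then (1 : ℝ) else 0) * (if b then 1 else 0) = if a ∧ b then 1 else 0 := by
  split_ifs <;> simp_all

theorem carreDuChamp_linear {p n : ℕ} (l₁ l₂ : ClSymm p n →L[ℝ] ℝ) (s₁ s₂ M : ClSymm p n)
    (h₁ : ∀ N, l₁ N = inner ℝ s₁ N) (h₂ : ∀ N, l₂ N = inner ℝ s₂ N) :
    carreDuChamp (clLaplacian p n) l₁ l₂ M = l₁ s₂ := by
  have hd : fderiv ℝ (fun N : ClSymm p n => l₁ N * l₂ N)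
      = ((ContinuousLinearMap.smulRightL ℝ (ClSymm p n) (ClSymm p n →L[ℝ] ℝ) l₁ l₂)
        + (ContinuousLinearMap.smulRightL ℝ (ClSymm p n) (ClSymm p n →L[ℝ] ℝ) l₂ l₁) :
          ClSymm p n →L[ℝ] ClSymm p n →L[ℝ] ℝ) := by
    ext x v
    rw [fderiv_fun_mul l₁.differentiableAt l₂.differentiableAt]
    simp
  have hL : clLaplacian p n (fun N : ClSymm p n => l₁ N * l₂ N) M = 2 * l₁ s₂ := by
    unfold clLaplacian
    rw [InnerProductSpace.laplacian_eq_iteratedFDeriv_stdOrthonormalBasis]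
    simp only [iteratedFDeriv_two_apply, hd, ContinuousLinearMap.fderiv]
    simp only [Matrix.cons_val_zero, Matrix.cons_val_one, add_apply,
      ContinuousLinearMap.smulRightL_apply_apply, ContinuousLinearMap.smulRight_apply,
      smul_apply, smul_eq_mul]
    rw [h₁ s₂, ← OrthonormalBasis.sum_inner_mul_inner (stdOrthonormalBasis ℝ (ClSymm p n)) s₁ s₂,
      Finset.mul_sum]
    refine Finset.sum_congr rfl fun k _ => ?_
    rw [h₁, h₂, real_inner_comm s₂]
    ring
  unfold carreDuChamp
  rw [hL, clLaplacian_linear, clLaplacian_linear]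
  ring

/-- The Laplace operator has
`Γ(M^A_{ij}, M^B_{kl}) = (1/2) δ_{A,B} (δ_{ik} δ_{jl} + (A|A) δ_{il} δ_{jk})`. -/
theorem carreDuChamp_coord {p n : ℕ} (A B : Finset (Fin p)) (i j k l : Fin n) (M : ClSymm p n) :
    carreDuChamp (clLaplacian p n) (clCoord A i j) (clCoord B k l) M =
      1 / 2 * (if A = B then 1 else 0) *
        ((if i = k then 1 else 0) * (if j = l then 1 else 0)
          + clSign A A * ((if i = l then 1 else 0) * (if j = k then 1 else 0))) := by
  classical
  have hs : ∀ (A : Finset (Fin p)) (i j : Fin n), ∃ s : ClSymm p n,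
      (∀ N : ClSymm p n, clCoord A i j N = inner ℝ s N) ∧
      ∀ B k l, (s : ClMatrix p n) (B, k, l) = 1 / 2 * ((if (B, k, l) = (A, i, j) then 1 else 0)
        + clSign A A * (if (B, k, l) = (A, j, i) then 1 else 0)) := by
    intro A i j
    refine ⟨⟨(1 / 2 : ℝ) • (EuclideanSpace.single (A, i, j) (1 : ℝ)
      + clSign A A • EuclideanSpace.single (A, j, i) (1 : ℝ)), ?_⟩, ?_, ?_⟩
    · rw [mem_clSymm_iff]
      intro B k l
      simp only [PiLp.smul_apply, PiLp.add_apply, smul_eq_mul, PiLp.single_apply,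
        Prod.mk.injEq]
      by_cases hB : B = A
      · subst hB
        have := clSign_mul_self B B
        simp only [true_and, and_comm (a := l = _)]
        split_ifs <;> linarith
      · simp [hB]
    · intro N
      have hN := (mem_clSymm_iff (N : ClMatrix p n)).1 N.2 A i j
      have := clSign_mul_self A A
      simp only [Submodule.coe_inner, inner_smul_left, inner_add_left,
        EuclideanSpace.inner_single_left]
      simp only [clCoord, ContinuousLinearMap.comp_apply, Submodule.subtypeL_apply, hN]
      simp
      linear_combination (-(1 / 2) * (N : ClMatrix p n) (A, i, j)) * this
    · intro B k l
      simp only [PiLp.smul_apply, PiLp.add_apply, smul_eq_mul, PiLp.single_apply]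
  obtain ⟨s₁, h₁, -⟩ := hs A i j
  obtain ⟨s₂, h₂, e₂⟩ := hs B k l
  rw [carreDuChamp_linear _ _ s₁ s₂ M h₁ h₂]
  change (s₂ : ClMatrix p n) (A, i, j) = _
  rw [e₂]
  by_cases hAB : A = B
  · subst hAB
    clear e₂ h₁ h₂ hs
    generalize clSign A A = t
    simp only [Prod.mk.injEq, true_and, if_true, mul_one]
    simp only [ite_and_mul_ite]
  · simp [hAB]

/-!
Write `𝓜` for the block matrix of `M`, `U = (𝓜 - x)⁻¹` and `s = ∑_A (A|A)`. Everything rests on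
two facts. First, `U` commutes with the right multiplications by the `ω_B` and is symmetric, so it
is the block matrix of some Clifford-symmetric family `u`. Secondly, the trace form of block
matrices is `2 ^ p` times the Euclidean inner product (`ClMatrix.trace_block_mul_block`). By
Jacobi's formula, the gradient of `log |P(x)|` is therefore `2 ^ p u`, so that
`Γ(log P(x), log P(y)) = 2 ^ p trace (U(x) U(y))`, and the resolvent identity
`U(x) - U(y) = (x - y) U(x) U(y)` with `trace U = -P' / P` gives the formula for `Γ(P(x), P(y))`.

For `L(P)` one also needs the second-order term, the sum of `-trace (U e U e)` over an orthonormal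
basis. The orthogonal projection onto the Clifford-symmetric families is `M ↦ (M + M*) / 2`, with
`M*` the family of the transposed block matrix. The first half contributes `-½ s trace (U²)`,
because `(C|C) ω_A ω_C ω_A = (A ∆ C|A ∆ C) ω_C`; the second contributes `-½ (trace U)²`, because
averaging over conjugation by the `ω_A` projects onto the centre, which is `ℝ ω_∅` for `p` even.
This is `ClMatrix.sum_trace_orthonormalBasis`. Finally `s = Re (1+i)^p - Im (1+i)^p`.

For an `a`-th root `Q` of `P`, the chain rule for `P = Q ^ a` turns these formulas into formulas
for `Γ(Q(x), Q(y))` and `L(Q)`; the terms in `Q'²` cancel since `a² + a s = 2 ^ (p + 1)`. All the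
identities are proved where `P` does not vanish and extended to the other real points because, `M`
being fixed, both sides are polynomial in `x` and `y`.

For the existence of `Q`, the generalized eigenspaces of `𝓜` are stable under the right
multiplications by the generators, hence are representations of the Clifford algebra with `p`
generators of square `-1`. The dimension of such a representation is divisible by `a`
(`cliffordDvd_of_even`): a pair of generators with opposite squares doubles dimensions,
multiplying four generators by their product changes the signs of their squares, which yields Bott
periodicity, and the remaining small cases are settled by such doublings and by quaternionic
structures. As `𝓜` is diagonalizable, its characteristic polynomial is an `a`-th power for every
`M`. The `a`-th root of a monic polynomial is determined by the leading coefficients through a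
recursion with rational coefficients, so the root of the generic characteristic polynomial at
infinity, which has polynomial coefficients, specializes to the root for each `M`
(`exists_generic_root`).
-/

/-! ### Sums of signs over the subsets of `E` -/

theorem clSign_symmDiff_self {p : ℕ} (A C : Finset (Fin p)) :
    clSign (symmDiff C A) (symmDiff C A) =
      clSign A A * (clSign C A * clSign A C) * clSign C C := by
  rw [clSign_symmDiff_left, clSign_symmDiff_right, clSign_symmDiff_right]; ring

/-- `(A|A) = Re(i^|A|) - Im(i^|A|)`, a closed form of `(-1)^{|A|(|A|+1)/2}`. -/
theorem clSign_self_eq_re_sub_im {p : ℕ} (A : Finset (Fin p)) :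
    clSign A A = (Complex.I ^ A.card).re - (Complex.I ^ A.card).im := by
  -- the largest element of a subset of cardinality `k + 1` contributes the sign `(-1) ^ (k + 1)`
  have key : ∀ k : ℕ, (Complex.I ^ (k + 1)).re - (Complex.I ^ (k + 1)).im =
      (-1) ^ (k + 1) * ((Complex.I ^ k).re - (Complex.I ^ k).im) := by
    intro k
    -- both sides have period `4` in `k`
    have h4 : Complex.I ^ 4 = 1 := Complex.I_pow_four
    have hk : k = 4 * (k / 4) + k % 4 := (Nat.div_add_mod k 4).symm
    have h1 : (-1 : ℝ) ^ 4 = 1 := by norm_num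
    have hlt : k % 4 < 4 := Nat.mod_lt _ (by norm_num)
    rw [hk]
    simp only [pow_add, pow_mul, h4, h1, one_pow, one_mul]
    interval_cases k % 4 <;> simp [pow_succ]
  induction A using Finset.induction_on_max with
  | empty => simp [clSign]
  | insert a A hA ih =>
    have ha : a ∉ A := fun h => lt_irrefl _ (hA a h)
    have h1 : ∏ j ∈ A, genSign a j = (-1) ^ A.card := by
      rw [← Finset.prod_const]
      exact Finset.prod_congr rfl fun j hj => by simp [genSign, (hA j hj).le]
    have h2 : ∏ i ∈ A, genSign i a = 1 :=
      Finset.prod_eq_one fun i hi => by simp [genSign, hA i hi]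
    rw [Finset.card_insert_of_notMem ha, key, ← ih]
    simp only [clSign, Finset.prod_insert ha, Finset.prod_mul_distrib, h1, h2]
    simp [genSign]; ring

/-- The sum of the squares `ω_A² = (A|A)` is `Re (1+i)^p - Im (1+i)^p`. -/
theorem sum_clSign_self (p : ℕ) :
    ∑ A : Finset (Fin p), clSign A A =
      ((1 + Complex.I) ^ p).re - ((1 + Complex.I) ^ p).im := by
  have h : (1 + Complex.I) ^ p = ∑ A : Finset (Fin p), Complex.I ^ A.card := by
    have := Finset.prod_one_add (f := fun _ : Fin p => Complex.I) Finset.univ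
    simpa using this
  rw [h, Complex.re_sum, Complex.im_sum, ← Finset.sum_sub_distrib]
  exact Finset.sum_congr rfl fun A _ => clSign_self_eq_re_sub_im A

theorem one_add_I_pow_four_mul (m : ℕ) : (1 + Complex.I) ^ (4 * m) = (((-4) ^ m : ℝ) : ℂ) := by
  have : (1 + Complex.I) ^ 4 = -4 := by
    have h : (1 + Complex.I) ^ 2 = 2 * Complex.I := by linear_combination Complex.I_sq
    calc (1 + Complex.I) ^ 4 = ((1 + Complex.I) ^ 2) ^ 2 := by ring
      _ = -4 := by rw [h]; linear_combination 4 * Complex.I_sq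
  rw [pow_mul, this]; push_cast; rfl

theorem sum_clSign_self_four_mul (m : ℕ) :
    ∑ A : Finset (Fin (4 * m)), clSign A A = (-4) ^ m := by
  rw [sum_clSign_self, one_add_I_pow_four_mul, Complex.ofReal_re, Complex.ofReal_im, sub_zero]

theorem sum_clSign_self_four_mul_add_two (m : ℕ) :
    ∑ A : Finset (Fin (4 * m + 2)), clSign A A = -2 * (-4) ^ m := by
  have h : (1 + Complex.I) ^ 2 = 2 * Complex.I := by linear_combination Complex.I_sq
  rw [sum_clSign_self, pow_add, one_add_I_pow_four_mul, h, Complex.re_ofReal_mul,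
    Complex.im_ofReal_mul]
  simp; ring

/-- For `p` even the centre of `Cl(E)` is `ℝ ω_∅`: every other `ω_C` anticommutes with some
generator. -/
theorem exists_clSign_anticomm {p : ℕ} (hp : Even p) {C : Finset (Fin p)} (hC : C ≠ ∅) :
    ∃ k : Fin p, clSign C {k} * clSign {k} C = -1 := by
  have h : ∀ k : Fin p, clSign C {k} * clSign {k} C = ∏ j ∈ C, if j = k then 1 else -1 := by
    intro k
    simp only [clSign, Finset.prod_singleton, ← Finset.prod_mul_distrib]
    refine Finset.prod_congr rfl fun j _ => ?_
    unfold genSign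
    rcases lt_trichotomy j k with h | h | h
    · simp [h, h.ne, h.le, not_lt]
    · simp [h]
    · simp [h, h.ne', h.le, not_lt]
  rcases Nat.even_or_odd C.card with he | ho
  · obtain ⟨k, hk⟩ := Finset.nonempty_iff_ne_empty.2 hC
    refine ⟨k, ?_⟩
    have hodd : Odd (C.erase k).card := by
      have := Finset.card_erase_add_one hk
      by_contra hcon
      rw [Nat.not_odd_iff_even] at hcon
      rw [← this] at he
      exact (Nat.not_even_iff_odd.2 hcon.add_one) he
    rw [h, ← Finset.mul_prod_erase _ _ hk, if_pos rfl, one_mul,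
      Finset.prod_congr rfl fun j hj => if_neg (Finset.ne_of_mem_erase hj), Finset.prod_const,
      hodd.neg_one_pow]
  · have : C ≠ Finset.univ := by
      rintro rfl
      simp only [Finset.card_univ, Fintype.card_fin] at ho
      exact Nat.not_even_iff_odd.2 ho hp
    obtain ⟨k, hk⟩ : ∃ k, k ∉ C := by
      by_contra! hcon
      exact this (Finset.eq_univ_iff_forall.2 hcon)
    refine ⟨k, ?_⟩
    rw [h, Finset.prod_congr rfl fun j hj => if_neg (fun e : j = k => hk (e ▸ hj)),
      Finset.prod_const, ho.neg_one_pow]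

theorem sum_symmDiff_left {p : ℕ} (f : Finset (Fin p) → ℝ) (A : Finset (Fin p)) :
    ∑ B : Finset (Fin p), f (symmDiff A B) = ∑ B : Finset (Fin p), f B :=
  Function.Bijective.sum_comp (Function.Involutive.bijective fun B =>
    symmDiff_symmDiff_cancel_left A B) f

/-- Conjugation by the `ω_A` averages `ω_C` to zero unless `ω_C` is central. -/
theorem sum_clSign_comm {p : ℕ} (hp : Even p) (C : Finset (Fin p)) :
    ∑ A : Finset (Fin p), clSign C A * clSign A C = if C = ∅ then 2 ^ p else 0 := by
  split_ifs with hC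
  · subst hC
    simp [clSign_empty_left, clSign_empty_right]
  · obtain ⟨k, hk⟩ := exists_clSign_anticomm hp hC
    have h : ∑ A : Finset (Fin p), clSign C A * clSign A C =
        ∑ A : Finset (Fin p), -(clSign C A * clSign A C) := by
      rw [← sum_symmDiff_left _ {k}]
      refine Finset.sum_congr rfl fun A _ => ?_
      rw [clSign_symmDiff_right, clSign_symmDiff_left]
      linear_combination (clSign C A * clSign A C) * hk
    rw [Finset.sum_neg_distrib] at h
    linarith

/-- The reindexing `C = A ∆ B` of a sum over pairs of subsets. -/
theorem sum_sum_symmDiff {p : ℕ} (f : Finset (Fin p) → Finset (Fin p) → ℝ) :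
    ∑ A : Finset (Fin p), ∑ B : Finset (Fin p), f A B =
      ∑ C : Finset (Fin p), ∑ A : Finset (Fin p), f A (symmDiff A C) := by
  rw [Finset.sum_comm (γ := Finset (Fin p)) (f := fun C A => f A (symmDiff A C))]
  refine Finset.sum_congr rfl fun A _ => ?_
  exact (sum_symmDiff_left (f A) A).symm

/-! ### Traces in the block representation -/

namespace ClMatrix

variable {p n : ℕ}

theorem block_apply (M : ClMatrix p n) (A B : Finset (Fin p)) (i j : Fin n) :
    M.block (A, i) (B, j) = clSign (symmDiff A B) B * M (symmDiff A B, i, j) := rfl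

theorem block_add (M N : ClMatrix p n) : (M + N).block = M.block + N.block := by
  ext r c; simp [block, comp, mul_add]

theorem block_smul (t : ℝ) (M : ClMatrix p n) : (t • M).block = t • M.block := by
  ext r c; simp [block, comp]; ring

/-- The block representation as a linear map. -/
noncomputable def blockₗ (p n : ℕ) :
    ClMatrix p n →ₗ[ℝ] Matrix (Finset (Fin p) × Fin n) (Finset (Fin p) × Fin n) ℝ where
  toFun := block
  map_add' := block_add
  map_smul' := block_smul

theorem trace_block (u : ClMatrix p n) : u.block.trace = 2 ^ p * ∑ i, u (∅, i, i) := by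
  simp only [Matrix.trace, Matrix.diag_apply, Fintype.sum_prod_type, block_apply, symmDiff_self,
    Finset.bot_eq_empty, clSign_empty_left, one_mul]
  simp

/-- On Clifford-symmetric families the trace form of the block matrices is `2 ^ p` times the
Euclidean inner product. -/
theorem trace_block_mul_block (u v : ClMatrix p n) (hv : v ∈ ClSymm p n) :
    (u.block * v.block).trace = 2 ^ p * inner ℝ u v := by
  rw [mem_clSymm_iff] at hv
  have h : (u.block * v.block).trace = ∑ A : Finset (Fin p), ∑ B : Finset (Fin p), ∑ i, ∑ j,
      u (symmDiff A B, i, j) * v (symmDiff A B, i, j) := by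
    simp only [Matrix.trace, Matrix.diag_apply, Matrix.mul_apply, Fintype.sum_prod_type]
    refine Finset.sum_congr rfl fun A _ => ?_
    rw [Finset.sum_comm]
    refine Finset.sum_congr rfl fun B _ => Finset.sum_congr rfl fun i _ =>
      Finset.sum_congr rfl fun j _ => ?_
    have e := clSign_symmDiff_right (symmDiff A B) A B
    have e2 := clSign_mul_self (symmDiff A B) A
    have e3 := clSign_mul_self (symmDiff A B) B
    rw [block_apply, block_apply, symmDiff_comm B A, hv _ i j, e]
    linear_combination (u (symmDiff A B, i, j) * v (symmDiff A B, i, j) *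
      clSign (symmDiff A B) B * clSign (symmDiff A B) B) * e2 +
      (u (symmDiff A B, i, j) * v (symmDiff A B, i, j)) * e3
  rw [h, sum_sum_symmDiff]
  simp only [symmDiff_symmDiff_cancel_left, Finset.sum_const, Finset.card_univ,
    Fintype.card_finset, Fintype.card_fin, nsmul_eq_mul, ← Finset.mul_sum]
  simp only [PiLp.inner_apply, Fintype.sum_prod_type, RCLike.inner_apply, conj_trivial,
    Nat.cast_pow, Nat.cast_ofNat, mul_comm (u _)]

theorem block_single_apply (A B C : Finset (Fin p)) (i j k l : Fin n) :
    block (EuclideanSpace.single (A, i, j) (1 : ℝ)) (B, k) (C, l) =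
      if C = symmDiff A B ∧ k = i ∧ l = j then clSign A C else 0 := by
  rw [block_apply, PiLp.single_apply]
  have : symmDiff B C = A ↔ C = symmDiff A B := by
    constructor
    · rintro rfl; rw [symmDiff_comm B C, symmDiff_symmDiff_cancel_right]
    · rintro rfl; rw [symmDiff_comm A B, symmDiff_symmDiff_cancel_left]
  by_cases h : symmDiff B C = A
  · simp [h, ← this]
  · simp [h, ← this]

theorem mul_block_single_apply (u : ClMatrix p n) (A B C : Finset (Fin p)) (i j k l : Fin n) :
    (u.block * block (EuclideanSpace.single (A, i, j) (1 : ℝ))) (B, k) (C, l) =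
      if l = j then clSign A C * u.block (B, k) (symmDiff A C, i) else 0 := by
  rw [Matrix.mul_apply, Fintype.sum_eq_single (symmDiff A C, i)]
  · rw [block_single_apply]
    simp [mul_comm]
  · rintro ⟨D, m⟩ h
    rw [block_single_apply, if_neg, mul_zero]
    rintro ⟨rfl, rfl, rfl⟩
    simp at h

/-- The trace of `U (E_{ij} ω_A) U (E_{kl} ω_A)` for a block matrix `U`. -/
theorem trace_block_mul_single (u : ClMatrix p n) (A : Finset (Fin p)) (i j k l : Fin n) :
    (u.block * block (EuclideanSpace.single (A, i, j) (1 : ℝ)) *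
      (u.block * block (EuclideanSpace.single (A, k, l) (1 : ℝ)))).trace =
      2 ^ p * ∑ C, clSign (symmDiff C A) (symmDiff C A) * (u (C, l, i) * u (C, j, k)) := by
  have h : (u.block * block (EuclideanSpace.single (A, i, j) (1 : ℝ)) *
      (u.block * block (EuclideanSpace.single (A, k, l) (1 : ℝ)))).trace =
      ∑ B, ∑ D, clSign A D * u.block (B, l) (symmDiff A D, i) *
        (clSign A B * u.block (D, j) (symmDiff A B, k)) := by
    simp only [Matrix.trace, Matrix.diag_apply]
    simp only [Matrix.mul_apply (M := u.block * _) (N := u.block * _), Fintype.sum_prod_type,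
      mul_block_single_apply]
    refine Finset.sum_congr rfl fun B _ => ?_
    rw [Finset.sum_comm]
    simp
  rw [h, sum_sum_symmDiff]
  have h2 : ∀ C B : Finset (Fin p),
      clSign A (symmDiff B C) * u.block (B, l) (symmDiff A (symmDiff B C), i) *
        (clSign A B * u.block (symmDiff B C, j) (symmDiff A B, k)) =
      clSign C C * (u (symmDiff C A, l, i) * u (symmDiff C A, j, k)) := by
    intro C B
    have e1 : symmDiff B (symmDiff A (symmDiff B C)) = symmDiff C A := by
      rw [symmDiff_left_comm, symmDiff_symmDiff_cancel_left, symmDiff_comm]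
    have e2 : symmDiff (symmDiff B C) (symmDiff A B) = symmDiff C A := by
      rw [symmDiff_comm B C, symmDiff_assoc, symmDiff_left_comm B A B, symmDiff_self]
      simp
    rw [block_apply, block_apply, e1, e2]
    simp only [clSign_symmDiff_left, clSign_symmDiff_right]
    have a1 := clSign_mul_self A B
    have a2 := clSign_mul_self A C
    have a3 := clSign_mul_self A A
    have a4 := clSign_mul_self C A
    have a5 := clSign_mul_self C B
    calc _ = (clSign A B * clSign A B) * (clSign A B * clSign A B) *
          (clSign A C * clSign A C) * (clSign A A * clSign A A) * (clSign C A * clSign C A) *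
          (clSign C B * clSign C B) *
          (clSign C C * (u (symmDiff C A, l, i) * u (symmDiff C A, j, k))) := by ring
      _ = _ := by rw [a1, a2, a3, a4, a5]; ring
  simp only [h2, Finset.sum_const, Finset.card_univ, Fintype.card_finset, Fintype.card_fin,
    nsmul_eq_mul, ← Finset.mul_sum]
  rw [← sum_symmDiff_left _ A]
  simp [symmDiff_comm _ A]

/-! ### Right multiplications -/

/-- The matrix of the right multiplication `x ↦ x ω_B` on `ℝⁿ ⊗ Cl(E)`. -/
noncomputable def rightMul (n : ℕ) (B : Finset (Fin p)) :
    Matrix (Finset (Fin p) × Fin n) (Finset (Fin p) × Fin n) ℝ :=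
  Matrix.of fun r c => if r.1 = symmDiff c.1 B ∧ r.2 = c.2 then clSign c.1 B else 0

theorem mul_rightMul_apply (T : Matrix (Finset (Fin p) × Fin n) (Finset (Fin p) × Fin n) ℝ)
    (B C : Finset (Fin p)) (r : Finset (Fin p) × Fin n) (j : Fin n) :
    (T * rightMul n B) r (C, j) = clSign C B * T r (symmDiff C B, j) := by
  rw [Matrix.mul_apply, Fintype.sum_eq_single (symmDiff C B, j)]
  · simp [rightMul, mul_comm]
  · rintro ⟨D, m⟩ h
    simp only [rightMul, Matrix.of_apply]
    rw [if_neg, mul_zero]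
    rintro ⟨rfl, rfl⟩
    exact h rfl

theorem rightMul_mul_apply (T : Matrix (Finset (Fin p) × Fin n) (Finset (Fin p) × Fin n) ℝ)
    (B A : Finset (Fin p)) (c : Finset (Fin p) × Fin n) (i : Fin n) :
    (rightMul n B * T) (A, i) c = clSign (symmDiff A B) B * T (symmDiff A B, i) c := by
  rw [Matrix.mul_apply, Fintype.sum_eq_single (symmDiff A B, i)]
  · simp [rightMul]
  · rintro ⟨D, m⟩ h
    simp only [rightMul, Matrix.of_apply]
    rw [if_neg, zero_mul]
    rintro ⟨rfl, rfl⟩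
    exact h (by simp)

theorem rightMul_empty : rightMul (p := p) n ∅ = 1 := by
  ext ⟨A, i⟩ ⟨B, j⟩
  have h : symmDiff B ∅ = B := symmDiff_bot B
  simp [rightMul, Matrix.one_apply, clSign_empty_right, h]

theorem rightMul_mul_rightMul (B C : Finset (Fin p)) :
    rightMul n B * rightMul n C = clSign C B • rightMul n (symmDiff C B) := by
  ext ⟨A, i⟩ ⟨D, j⟩
  rw [mul_rightMul_apply]
  simp only [rightMul, Matrix.of_apply, Matrix.smul_apply, smul_eq_mul, symmDiff_assoc,
    clSign_symmDiff_left, clSign_symmDiff_right]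
  split_ifs <;> ring

theorem rightMul_singleton_mul_self (k : Fin p) : rightMul n {k} * rightMul n {k} = -1 := by
  rw [rightMul_mul_rightMul, clSign_generator_self, symmDiff_self, Finset.bot_eq_empty,
    rightMul_empty, neg_one_smul]

theorem rightMul_singleton_anticomm {k l : Fin p} (h : k ≠ l) :
    rightMul n {k} * rightMul n {l} = -(rightMul n {l} * rightMul n {k}) := by
  have e : clSign {l} {k} = -clSign {k} {l} := by
    linear_combination clSign {k} {l} * clSign_generator_anticomm h -
      clSign {l} {k} * clSign_mul_self {k} {l}
  rw [rightMul_mul_rightMul, rightMul_mul_rightMul, symmDiff_comm, e, neg_smul]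

/-- Associativity: left and right multiplications commute. -/
theorem commute_block_rightMul (M : ClMatrix p n) (B : Finset (Fin p)) :
    Commute M.block (rightMul n B) := by
  ext ⟨A, i⟩ ⟨C, j⟩
  have h : symmDiff (symmDiff A B) C = symmDiff A (symmDiff C B) := by
    rw [symmDiff_assoc, symmDiff_comm B C]
  rw [mul_rightMul_apply, rightMul_mul_apply, block_apply, block_apply, h]
  simp only [clSign_symmDiff_left, clSign_symmDiff_right]
  linear_combination (clSign A C * clSign A B * clSign C C * clSign B C * clSign B B *
    M (symmDiff A (symmDiff C B), i, j)) * clSign_mul_self C B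

/-- A matrix commuting with all right multiplications is a left multiplication. -/
theorem exists_block_eq_of_commute
    (T : Matrix (Finset (Fin p) × Fin n) (Finset (Fin p) × Fin n) ℝ)
    (hT : ∀ B, Commute T (rightMul n B)) : ∃ u : ClMatrix p n, u.block = T := by
  refine ⟨WithLp.toLp 2 fun s => T (s.1, s.2.1) (∅, s.2.2), ?_⟩
  ext ⟨A, i⟩ ⟨B, j⟩
  have := congrFun (congrFun (hT B) (A, i)) (∅, j)
  rw [mul_rightMul_apply, rightMul_mul_apply, clSign_empty_left, one_mul,
    ← Finset.bot_eq_empty, bot_symmDiff] at this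
  rw [block_apply, this]
  rfl

/-! ### Summation over an orthonormal basis of the Clifford-symmetric matrices -/

/-- The sum of a bilinear form over an orthonormal basis of the Clifford-symmetric families, in
terms of the coordinates of the ambient space: the orthogonal projection of `E_{ij} ω_A` is half
of `E_{ij} ω_A + (A|A) E_{ji} ω_A`. -/
theorem sum_bilin_orthonormalBasis {ι : Type*} [Fintype ι]
    (e : OrthonormalBasis ι ℝ (ClSymm p n)) (β : ClMatrix p n →ₗ[ℝ] ClMatrix p n →ₗ[ℝ] ℝ) :
    ∑ k, β (e k) (e k) = ∑ A, ∑ i, ∑ j, 1 / 2 *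
      (β (EuclideanSpace.single (A, i, j) 1) (EuclideanSpace.single (A, i, j) 1) +
        clSign A A *
          β (EuclideanSpace.single (A, i, j) 1) (EuclideanSpace.single (A, j, i) 1)) := by
  have hproj : ∀ A i j, ∑ k, (e k : ClMatrix p n) (A, i, j) • (e k : ClMatrix p n) =
      (1 / 2 : ℝ) • (EuclideanSpace.single (A, i, j) (1 : ℝ) +
        clSign A A • EuclideanSpace.single (A, j, i) (1 : ℝ)) := by
    intro A i j
    set σ : ClMatrix p n := (1 / 2 : ℝ) • (EuclideanSpace.single (A, i, j) (1 : ℝ) +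
        clSign A A • EuclideanSpace.single (A, j, i) (1 : ℝ)) with hσ
    have hmem : σ ∈ ClSymm p n := by
      rw [mem_clSymm_iff]
      intro B k l
      simp only [hσ, PiLp.smul_apply, PiLp.add_apply, smul_eq_mul, PiLp.single_apply,
        Prod.mk.injEq]
      by_cases hB : B = A
      · subst hB
        have := clSign_mul_self B B
        simp only [true_and, and_comm (a := l = _)]
        split_ifs <;> linarith
      · simp [hB]
    have hin : ∀ N : ClSymm p n, (N : ClMatrix p n) (A, i, j) = inner ℝ N ⟨σ, hmem⟩ := by
      intro N
      have hN := (mem_clSymm_iff (N : ClMatrix p n)).1 N.2 A i j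
      have := clSign_mul_self A A
      rw [real_inner_comm]
      simp only [Submodule.coe_inner, hσ, inner_smul_left, inner_add_left,
        EuclideanSpace.inner_single_left, hN]
      simp
      linear_combination (-(1 / 2) * (N : ClMatrix p n) (A, i, j)) * this
    have := congrArg (Subtype.val) (e.sum_repr' ⟨σ, hmem⟩)
    refine Eq.trans ?_ this
    simp [hin]
  have hexp : ∀ N : ClMatrix p n, N = ∑ s, N s • EuclideanSpace.single s (1 : ℝ) := by
    intro N
    have := (EuclideanSpace.basisFun (Finset (Fin p) × Fin n × Fin n) ℝ).sum_repr N
    simpa using this.symm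
  calc ∑ k, β (e k) (e k) = ∑ k, ∑ s, (e k : ClMatrix p n) s •
        β (EuclideanSpace.single s 1) (e k) := by
        refine Finset.sum_congr rfl fun k _ => ?_
        conv_lhs => enter [1]; rw [hexp (e k : ClMatrix p n)]
        simp
    _ = ∑ s, β (EuclideanSpace.single s 1)
        (∑ k, (e k : ClMatrix p n) s • (e k : ClMatrix p n)) := by
        rw [Finset.sum_comm]
        simp
    _ = _ := by
        simp only [Fintype.sum_prod_type, hproj, map_smul, map_add, smul_eq_mul]

/-- The second-order trace identity behind `L(log P)`: for `p` even and a Clifford-symmetric `u`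
with block matrix `U`, the sum of `trace (U e U e)` over an orthonormal basis. The two halves of
the orthogonal projection give `∑_A (A|A)` copies of `trace (U²)`, and `(trace U)²`, as only
`ω_∅` is central. -/
theorem sum_trace_orthonormalBasis {ι : Type*} [Fintype ι] (hp : Even p)
    (e : OrthonormalBasis ι ℝ (ClSymm p n)) (u : ClMatrix p n) (hu : u ∈ ClSymm p n) :
    ∑ k, (u.block * block (e k) * (u.block * block (e k))).trace =
      1 / 2 * ((∑ A : Finset (Fin p), clSign A A) * (u.block * u.block).trace +
        u.block.trace ^ 2) := by
  let φ : ClMatrix p n →ₗ[ℝ] Matrix (Finset (Fin p) × Fin n) (Finset (Fin p) × Fin n) ℝ :=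
    (LinearMap.mulLeft ℝ u.block).comp (blockₗ p n)
  let β : ClMatrix p n →ₗ[ℝ] ClMatrix p n →ₗ[ℝ] ℝ :=
    ((LinearMap.mul ℝ _).compl₁₂ φ φ).compr₂ (Matrix.traceLinearMap _ ℝ ℝ)
  have hβ : ∀ v w, β v w = (u.block * block v * (u.block * block w)).trace := fun v w => rfl
  simp only [← hβ, sum_bilin_orthonormalBasis]
  simp only [hβ, trace_block_mul_single]
  rw [trace_block_mul_block u u hu, trace_block]
  have hrot : ∀ f : Fin n → Fin n → Finset (Fin p) → ℝ,
      ∑ i, ∑ j, ∑ C, f i j C = ∑ C, ∑ i, ∑ j, f i j C := fun f => by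
    rw [Finset.sum_comm (s := (Finset.univ : Finset (Finset (Fin p))))]
    exact Finset.sum_congr rfl fun i _ => Finset.sum_comm
  -- the part of the projection that is half the identity
  have h1 : ∑ A : Finset (Fin p), ∑ i : Fin n, ∑ j : Fin n, ∑ C : Finset (Fin p),
      clSign (symmDiff C A) (symmDiff C A) * (u (C, j, i) * u (C, j, i)) =
      (∑ A : Finset (Fin p), clSign A A) * inner ℝ u u := by
    have : ∀ A : Finset (Fin p), ∑ i : Fin n, ∑ j : Fin n, ∑ C : Finset (Fin p),
        clSign (symmDiff C A) (symmDiff C A) * (u (C, j, i) * u (C, j, i)) =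
        ∑ C, clSign (symmDiff C A) (symmDiff C A) * ∑ i, ∑ j, u (C, j, i) * u (C, j, i) := by
      intro A
      simp only [Finset.mul_sum]
      exact hrot _
    simp only [this]
    rw [Finset.sum_comm]
    simp only [← Finset.sum_mul, sum_symmDiff_left (fun A => clSign A A)]
    rw [← Finset.mul_sum]
    congr 1
    simp only [PiLp.inner_apply, Fintype.sum_prod_type, RCLike.inner_apply, conj_trivial]
    refine Finset.sum_congr rfl fun C _ => Finset.sum_comm
  -- the part with the transposed matrix: here `ω_A ω_C ω_A⁻¹` is summed over `A`
  have h2 : ∑ A : Finset (Fin p), ∑ i : Fin n, ∑ j : Fin n, clSign A A * ∑ C : Finset (Fin p),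
      clSign (symmDiff C A) (symmDiff C A) * (u (C, i, i) * u (C, j, j)) =
      2 ^ p * (∑ i, u (∅, i, i)) ^ 2 := by
    have : ∀ A : Finset (Fin p), ∑ i : Fin n, ∑ j : Fin n, clSign A A * ∑ C : Finset (Fin p),
        clSign (symmDiff C A) (symmDiff C A) * (u (C, i, i) * u (C, j, j)) =
        ∑ C, (clSign C A * clSign A C) * (clSign C C * ∑ i, ∑ j, u (C, i, i) * u (C, j, j)) := by
      intro A
      simp only [Finset.mul_sum]
      rw [hrot]
      refine Finset.sum_congr rfl fun C _ => Finset.sum_congr rfl fun i _ =>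
        Finset.sum_congr rfl fun j _ => ?_
      rw [clSign_symmDiff_self]
      linear_combination (clSign C A * clSign A C * clSign C C * u (C, i, i) * u (C, j, j)) *
        clSign_mul_self A A
    simp only [this]
    rw [Finset.sum_comm]
    simp only [← Finset.sum_mul, sum_clSign_comm hp]
    simp [clSign_empty_left, sq, Finset.sum_mul_sum]
  have key : ∀ f g : Finset (Fin p) → Fin n → Fin n → ℝ,
      ∑ A, ∑ i, ∑ j, 1 / 2 * (2 ^ p * f A i j + clSign A A * (2 ^ p * g A i j)) =
        1 / 2 * (2 ^ p * ∑ A, ∑ i, ∑ j, f A i j +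
          2 ^ p * ∑ A, ∑ i, ∑ j, clSign A A * g A i j) := fun f g => by
    simp only [Finset.mul_sum, ← Finset.sum_add_distrib]
    refine Finset.sum_congr rfl fun A _ => Finset.sum_congr rfl fun i _ =>
      Finset.sum_congr rfl fun j _ => by ring
  rw [key, h1, h2]
  ring

end ClMatrix

/-! ### Families of polynomials with smooth coefficients -/

/-- The value at `x` of a family of polynomials, in terms of the coefficient functions. -/
theorem eval_family_eq_sum {V : Type*} {F : V → ℝ[X]} {d : ℕ} (hd : ∀ N, (F N).natDegree ≤ d)
    (x : ℝ) :
    (fun N => (F N).eval x) = fun N => ∑ k ∈ Finset.range (d + 1), x ^ k * (F N).coeff k := by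
  ext N
  rw [Polynomial.eval_eq_sum_range' (Nat.lt_succ_of_le (hd N))]
  exact Finset.sum_congr rfl fun k _ => mul_comm _ _

section Laplacian

open Laplacian

variable {E : Type*} [NormedAddCommGroup E] [InnerProductSpace ℝ E]

variable {F : E → ℝ[X]} {d : ℕ}

theorem contDiff_eval_family (hd : ∀ N, (F N).natDegree ≤ d)
    (hF : ∀ k, ContDiff ℝ 2 fun N => (F N).coeff k) (x : ℝ) :
    ContDiff ℝ 2 fun N => (F N).eval x := by
  rw [eval_family_eq_sum hd]
  exact ContDiff.sum fun k _ => contDiff_const.mul (hF k)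

/-- A directional derivative of the value at `x` is polynomial in `x`. -/
theorem exists_fderiv_eval_family (hd : ∀ N, (F N).natDegree ≤ d)
    (hF : ∀ k, ContDiff ℝ 2 fun N => (F N).coeff k) (M v : E) :
    ∃ D : ℝ[X], ∀ x, fderiv ℝ (fun N => (F N).eval x) M v = D.eval x := by
  refine ⟨∑ k ∈ Finset.range (d + 1), C (fderiv ℝ (fun N => (F N).coeff k) M v) * X ^ k,
    fun x => ?_⟩
  have hk : ∀ k, DifferentiableAt ℝ (fun N => (F N).coeff k) M := fun k =>
    (hF k).contDiffAt.differentiableAt two_ne_zero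
  rw [eval_family_eq_sum hd, fderiv_fun_sum fun k _ => (hk k).const_mul _,
    Polynomial.eval_finsetSum]
  simp only [sum_apply, fderiv_const_mul (hk _), eval_mul, eval_C, eval_pow, eval_X, smul_apply,
    smul_eq_mul]
  exact Finset.sum_congr rfl fun k _ => mul_comm _ _

/-! ### The Laplacian and the carré du champ in an orthonormal basis -/

theorem ContDiffAt.differentiableAt_fderiv_apply {f : E → ℝ} {x : E} (hf : ContDiffAt ℝ 2 f x)
    (v : E) : DifferentiableAt ℝ (fun y => fderiv ℝ f y v) x :=
  ((hf.fderiv_right (m := 1) (by norm_num)).differentiableAt one_ne_zero).clm_apply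
    (differentiableAt_const v)

theorem ContDiffAt.eventually_differentiableAt {f : E → ℝ} {x : E} (hf : ContDiffAt ℝ 2 f x) :
    ∀ᶠ y in nhds x, DifferentiableAt ℝ f y :=
  (hf.eventually (by simp)).mono fun _ h => h.differentiableAt two_ne_zero

variable [FiniteDimensional ℝ E]

theorem ContDiffAt.laplacian_eq_sum {f : E → ℝ} {x : E} (hf : ContDiffAt ℝ 2 f x) :
    Δ f x = ∑ k, fderiv ℝ (fun y => fderiv ℝ f y (stdOrthonormalBasis ℝ E k)) x
      (stdOrthonormalBasis ℝ E k) := by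
  rw [InnerProductSpace.laplacian_eq_iteratedFDeriv_stdOrthonormalBasis]
  refine Finset.sum_congr rfl fun k _ => ?_
  have h := (hf.fderiv_right (m := 1) (by norm_num)).differentiableAt one_ne_zero
  rw [iteratedFDeriv_two_apply, fderiv_clm_apply h (differentiableAt_const _)]
  simp

theorem ContDiffAt.laplacian_mul {f g : E → ℝ} {x : E} (hf : ContDiffAt ℝ 2 f x)
    (hg : ContDiffAt ℝ 2 g x) :
    Δ (fun y => f y * g y) x = f x * Δ g x + g x * Δ f x +
      2 * ∑ k, fderiv ℝ f x (stdOrthonormalBasis ℝ E k) *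
        fderiv ℝ g x (stdOrthonormalBasis ℝ E k) := by
  rw [(hf.mul hg).laplacian_eq_sum, hf.laplacian_eq_sum, hg.laplacian_eq_sum, Finset.mul_sum,
    Finset.mul_sum, Finset.mul_sum, ← Finset.sum_add_distrib, ← Finset.sum_add_distrib]
  refine Finset.sum_congr rfl fun k _ => ?_
  set v := stdOrthonormalBasis ℝ E k
  have h : (fun y => fderiv ℝ (fun y => f y * g y) y v) =ᶠ[nhds x]
      fun y => f y * fderiv ℝ g y v + g y * fderiv ℝ f y v := by
    filter_upwards [hf.eventually_differentiableAt, hg.eventually_differentiableAt] with y h1 h2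
    rw [fderiv_fun_mul h1 h2]
    simp
  have hf1 := hf.differentiableAt two_ne_zero
  have hg1 := hg.differentiableAt two_ne_zero
  have hf2 := hf.differentiableAt_fderiv_apply v
  have hg2 := hg.differentiableAt_fderiv_apply v
  rw [h.fderiv_eq, fderiv_fun_add (hf1.fun_mul hg2) (hg1.fun_mul hf2), fderiv_fun_mul hf1 hg2,
    fderiv_fun_mul hg1 hf2]
  simp
  ring

theorem ContDiffAt.carreDuChamp_eq_sum {f g : E → ℝ} {x : E} (hf : ContDiffAt ℝ 2 f x)
    (hg : ContDiffAt ℝ 2 g x) :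
    carreDuChamp Δ f g x = ∑ k, fderiv ℝ f x (stdOrthonormalBasis ℝ E k) *
        fderiv ℝ g x (stdOrthonormalBasis ℝ E k) := by
  rw [carreDuChamp, hf.laplacian_mul hg]
  ring

theorem ContDiffAt.laplacian_pow {f : E → ℝ} {x : E} (hf : ContDiffAt ℝ 2 f x) (m : ℕ) :
    Δ (fun y => f y ^ (m + 2)) x = (m + 2) * f x ^ (m + 1) * Δ f x +
      (m + 2) * (m + 1) * f x ^ m * ∑ k, fderiv ℝ f x (stdOrthonormalBasis ℝ E k) *
        fderiv ℝ f x (stdOrthonormalBasis ℝ E k) := by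
  have hd : ∀ (m : ℕ) v, fderiv ℝ (fun y => f y ^ (m + 1)) x v =
      (m + 1) * f x ^ m * fderiv ℝ f x v := fun m v => by
    rw [fderiv_fun_pow _ (hf.differentiableAt two_ne_zero)]
    simp
  induction m with
  | zero =>
    have h : (fun y => f y ^ (0 + 2)) = fun y => f y * f y := by ext; ring
    rw [h, hf.laplacian_mul hf]
    push_cast; ring
  | succ m ih =>
    have h : (fun y => f y ^ (m + 1 + 2)) = fun y => f y ^ (m + 2) * f y := by ext; ring
    have hs : ∑ k, fderiv ℝ (fun y => f y ^ (m + 2)) x (stdOrthonormalBasis ℝ E k) *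
        fderiv ℝ f x (stdOrthonormalBasis ℝ E k) = (m + 2) * f x ^ (m + 1) *
        ∑ k, fderiv ℝ f x (stdOrthonormalBasis ℝ E k) *
        fderiv ℝ f x (stdOrthonormalBasis ℝ E k) := by
      rw [Finset.mul_sum]
      refine Finset.sum_congr rfl fun k _ => ?_
      rw [hd]; push_cast; ring
    rw [h, (hf.pow (m + 2)).laplacian_mul hf, ih, hs]
    push_cast; ring

/-- The Laplacian of the value at `x` is polynomial in `x`. -/
theorem exists_laplacian_eval_family (hd : ∀ N, (F N).natDegree ≤ d)
    (hF : ∀ k, ContDiff ℝ 2 fun N => (F N).coeff k) (M : E) :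
    ∃ D : ℝ[X], ∀ x, Δ (fun N => (F N).eval x) M = D.eval x := by
  have h : ∀ k : Fin (Module.finrank ℝ E), ∃ D : ℝ[X], ∀ x,
      fderiv ℝ (fun y => fderiv ℝ (fun N => (F N).eval x) y (stdOrthonormalBasis ℝ E k)) M
        (stdOrthonormalBasis ℝ E k) = D.eval x := by
    intro k
    set v := stdOrthonormalBasis ℝ E k
    refine ⟨∑ k ∈ Finset.range (d + 1), C (fderiv ℝ (fun y => fderiv ℝ (fun N => (F N).coeff k)
      y v) M v) * X ^ k, fun x => ?_⟩
    have hk : ∀ k N, DifferentiableAt ℝ (fun N => (F N).coeff k) N := fun k N =>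
      (hF k).contDiffAt.differentiableAt two_ne_zero
    have hk2 : ∀ k, DifferentiableAt ℝ (fun y => fderiv ℝ (fun N => (F N).coeff k) y v) M :=
      fun k => (hF k).contDiffAt.differentiableAt_fderiv_apply v
    have e : (fun y => fderiv ℝ (fun N => (F N).eval x) y v) = fun y =>
        ∑ k ∈ Finset.range (d + 1), x ^ k * fderiv ℝ (fun N => (F N).coeff k) y v := by
      ext y
      rw [eval_family_eq_sum hd, fderiv_fun_sum fun k _ => (hk k y).const_mul _]
      simp only [sum_apply, fderiv_const_mul (hk _ _)]
      simp
    rw [e, fderiv_fun_sum fun k _ => (hk2 k).const_mul _, Polynomial.eval_finsetSum]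
    simp only [sum_apply, fderiv_const_mul (hk2 _), eval_mul, eval_C, eval_pow, eval_X,
      smul_apply, smul_eq_mul]
    exact Finset.sum_congr rfl fun k _ => mul_comm _ _
  choose D hD using h
  refine ⟨∑ k, D k, fun x => ?_⟩
  rw [(contDiff_eval_family hd hF x).contDiffAt.laplacian_eq_sum, Polynomial.eval_finsetSum]
  exact Finset.sum_congr rfl fun k _ => hD k x

end Laplacian

/-- Two polynomials that agree outside the roots of a nonzero polynomial are equal. -/
theorem Polynomial.eq_of_eval_eq_of_eval_ne_zero {P A B : ℝ[X]} (hP : P ≠ 0)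
    (h : ∀ x, P.eval x ≠ 0 → A.eval x = B.eval x) : A = B := by
  have : P * (A - B) = 0 := Polynomial.funext fun x => by
    by_cases hx : P.eval x = 0
    · simp [hx]
    · simp [h x hx]
  exact sub_eq_zero.1 ((mul_eq_zero.1 this).resolve_left hP)

/-! ### Derivatives of the determinant and of the inverse along a line -/

theorem hasDerivAt_ringInverse_add_smul {R : Type*} [NormedRing R] [NormedAlgebra ℝ R]
    [FiniteDimensional ℝ R] (a : Rˣ) (h : R) (l : R →ₗ[ℝ] ℝ) :
    HasDerivAt (fun t : ℝ => l (Ring.inverse (a + t • h))) (-l (↑a⁻¹ * h * ↑a⁻¹)) 0 := by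
  have : CompleteSpace R := FiniteDimensional.complete ℝ R
  have h0 : HasDerivAt (fun t : ℝ => (a : R) + t • h) h 0 := by
    simpa using! ((hasDerivAt_id (0 : ℝ)).smul_const h).const_add (a : R)
  have h1 : HasFDerivAt Ring.inverse (-ContinuousLinearMap.mulLeftRight ℝ R
      (↑a⁻¹) (↑a⁻¹)) ((a : R) + (0 : ℝ) • h) := by
    rw [zero_smul, add_zero]; exact hasFDerivAt_ringInverse a
  have h3 := l.toContinuousLinearMap.hasFDerivAt.comp_hasDerivAt (0 : ℝ)
    (h1.comp_hasDerivAt (0 : ℝ) h0)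
  rw [neg_apply, ContinuousLinearMap.mulLeftRight_apply, map_neg] at h3
  exact h3

namespace Matrix

variable {m : Type*} [Fintype m] [DecidableEq m]

theorem hasDerivAt_det_add_smul (A H : Matrix m m ℝ) (hA : A.det ≠ 0) :
    HasDerivAt (fun t : ℝ => (A + t • H).det) (A.det * (A⁻¹ * H).trace) 0 := by
  -- `det (A + t H) = det A * det (1 + t A⁻¹ H)`, and the last factor is expanded to first order
  have e : (fun t : ℝ => (A + t • H).det) = fun t : ℝ => A.det * (1 +
      (A⁻¹ * H).trace * t + (det (1 + (X : ℝ[X]) • (A⁻¹ * H).map C)).divX.divX.eval t * t ^ 2) := by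
    ext t
    rw [← Matrix.det_one_add_smul, ← Matrix.det_mul, Matrix.mul_add, Matrix.mul_smul,
      Matrix.mul_one, Matrix.mul_nonsing_inv_cancel_left _ _ (isUnit_iff_ne_zero.2 hA)]
  rw [e]
  have h1 := ((det (1 + (X : ℝ[X]) • (A⁻¹ * H).map C)).divX.divX.hasDerivAt (0 : ℝ)).mul
    ((hasDerivAt_id (0 : ℝ)).pow 2)
  have h2 := (((hasDerivAt_id (0 : ℝ)).const_mul (A⁻¹ * H).trace).const_add 1).add h1
  convert! h2.const_mul A.det using 1
  simp

-- any norm making the matrices a normed algebra will do; the statement does not involve it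
open scoped Matrix.Norms.Operator in
theorem hasDerivAt_trace_inv_add_smul_mul (A H K : Matrix m m ℝ) (hA : A.det ≠ 0) :
    HasDerivAt (fun t : ℝ => ((A + t • H)⁻¹ * K).trace) (-(A⁻¹ * H * (A⁻¹ * K)).trace) 0 := by
  obtain ⟨a, rfl⟩ := (Matrix.isUnit_iff_isUnit_det A).2 (isUnit_iff_ne_zero.2 hA)
  have h := hasDerivAt_ringInverse_add_smul a H
    ((Matrix.traceLinearMap m ℝ ℝ).comp (LinearMap.mulRight ℝ K))
  convert! h using 1
  · ext t
    simp only [Matrix.nonsing_inv_eq_ringInverse]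
    rfl
  · rw [← Matrix.mul_assoc, Matrix.coe_units_inv]
    rfl

end Matrix

section ClSymm

variable {p n : ℕ}

/-! ### The characteristic polynomial of a Clifford-symmetric matrix -/

/-- The block matrix of the generic family, whose entries are indeterminates. -/
noncomputable def genericBlock (p n : ℕ) :
    Matrix (Finset (Fin p) × Fin n) (Finset (Fin p) × Fin n)
      (MvPolynomial (Finset (Fin p) × Fin n × Fin n) ℝ) :=
  Matrix.of fun r c => MvPolynomial.C (clSign (symmDiff r.1 c.1) c.1) *
    MvPolynomial.X (symmDiff r.1 c.1, r.2, c.2)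

theorem genericBlock_map_eval (M : ClMatrix p n) :
    (genericBlock p n).map (MvPolynomial.eval fun s => M s) = M.block := by
  ext r c
  simp [genericBlock, ClMatrix.block, ClMatrix.comp]

theorem genericBlock_charpoly_map_eval (M : ClMatrix p n) :
    (genericBlock p n).charpoly.map (MvPolynomial.eval fun s => M s) = M.block.charpoly := by
  rw [← genericBlock_map_eval, ← Matrix.charpoly_map]

theorem card_block_index : Fintype.card (Finset (Fin p) × Fin n) = 2 ^ p * n := by simp

theorem detPoly_eq (M : ClSymm p n) :
    detPoly M = C ((-1) ^ (2 ^ p * n)) * (M : ClMatrix p n).block.charpoly := by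
  have h : (M : ClMatrix p n).block.map C - (X : ℝ[X]) • 1 =
      -(M : ClMatrix p n).block.charmatrix := by
    rw [Matrix.charmatrix, neg_sub, Matrix.smul_one_eq_diagonal, Matrix.scalar_apply]
    rfl
  rw [detPoly, h, Matrix.det_neg, card_block_index, Matrix.charpoly]
  simp

theorem detPoly_ne_zero (M : ClSymm p n) : detPoly M ≠ 0 := by
  rw [detPoly_eq]
  exact mul_ne_zero (by simp) (Matrix.charpoly_monic _).ne_zero

theorem natDegree_detPoly (M : ClSymm p n) : (detPoly M).natDegree = 2 ^ p * n := by
  rw [detPoly_eq, natDegree_C_mul (by simp), Matrix.charpoly_natDegree_eq_dim, card_block_index]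

/-- The coefficients of `P` are polynomial in the entries, hence smooth. -/
theorem contDiff_coeff_detPoly (k : ℕ) :
    ContDiff ℝ 2 fun M : ClSymm p n => (detPoly M).coeff k := by
  have h : (fun M : ClSymm p n => (detPoly M).coeff k) = fun M : ClSymm p n =>
      (-1) ^ (2 ^ p * n) * MvPolynomial.eval (fun s => clCoord s.1 s.2.1 s.2.2 M)
        ((genericBlock p n).charpoly.coeff k) := by
    ext M
    rw [detPoly_eq, coeff_C_mul, ← genericBlock_charpoly_map_eval, coeff_map]
    rfl
  rw [h]
  refine contDiff_const.mul ?_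
  exact contDiffOn_univ.1 (AnalyticOnNhd.eval_continuousLinearMap'
    (fun s : Finset (Fin p) × Fin n × Fin n => clCoord s.1 s.2.1 s.2.2)
      _).contDiffOn_of_completeSpace

theorem detPoly_eval (M : ClSymm p n) (x : ℝ) :
    (detPoly M).eval x = ((M : ClMatrix p n).block - x • 1).det := by
  rw [detPoly, ← coe_evalRingHom, RingHom.map_det]
  congr 1
  ext r c
  simp [Matrix.one_apply]
  split_ifs <;> simp

theorem contDiff_detPoly_eval (x : ℝ) : ContDiff ℝ 2 fun M : ClSymm p n => (detPoly M).eval x :=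
  contDiff_eval_family (fun N => (natDegree_detPoly N).le) contDiff_coeff_detPoly x

/-! ### The resolvent -/

section Resolvent

variable (M : ClSymm p n) {x : ℝ}

theorem block_sub_smul_one_mul_clResolvent (hx : (detPoly M).eval x ≠ 0) :
    ((M : ClMatrix p n).block - x • 1) * clResolvent M x = 1 := by
  rw [detPoly_eval] at hx
  exact Matrix.mul_nonsing_inv _ (isUnit_iff_ne_zero.2 hx)

theorem clResolvent_mul_block_sub_smul_one (hx : (detPoly M).eval x ≠ 0) :
    clResolvent M x * ((M : ClMatrix p n).block - x • 1) = 1 := by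
  rw [detPoly_eval] at hx
  exact Matrix.nonsing_inv_mul _ (isUnit_iff_ne_zero.2 hx)

/-- The resolvent of a Clifford-symmetric matrix is again Clifford-symmetric: it is symmetric, and
commutes with the right multiplications. -/
theorem exists_block_eq_clResolvent (hx : (detPoly M).eval x ≠ 0) :
    ∃ u : ClSymm p n, (u : ClMatrix p n).block = clResolvent M x := by
  have h1 := block_sub_smul_one_mul_clResolvent M hx
  have h2 := clResolvent_mul_block_sub_smul_one M hx
  obtain ⟨u, hu⟩ := ClMatrix.exists_block_eq_of_commute (clResolvent M x) fun B => by
    have hc : Commute ((M : ClMatrix p n).block - x • 1) (ClMatrix.rightMul n B) :=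
      (ClMatrix.commute_block_rightMul _ B).sub_left ((Commute.one_left _).smul_left x)
    calc clResolvent M x * ClMatrix.rightMul n B
        = clResolvent M x * (ClMatrix.rightMul n B * ((M : ClMatrix p n).block - x • 1)) *
          clResolvent M x := by rw [mul_assoc, mul_assoc, h1, mul_one]
      _ = ClMatrix.rightMul n B * clResolvent M x := by
          rw [← hc.eq, ← mul_assoc, h2, one_mul]
  refine ⟨⟨u, ?_⟩, hu⟩
  change u.block.IsSymm
  have hs : ((M : ClMatrix p n).block - x • 1).IsSymm :=
    Matrix.IsSymm.sub M.2 (Matrix.isSymm_one.smul x)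
  rw [hu, clResolvent, Matrix.IsSymm, Matrix.transpose_nonsing_inv, hs.eq]

/-- The trace of the resolvent identity. -/
theorem trace_clResolvent_mul {y : ℝ} (hx : (detPoly M).eval x ≠ 0)
    (hy : (detPoly M).eval y ≠ 0) :
    (x - y) * (clResolvent M x * clResolvent M y).trace =
      (clResolvent M x).trace - (clResolvent M y).trace := by
  have h : clResolvent M x - clResolvent M y =
      (x - y) • (clResolvent M x * clResolvent M y) := by
    have e : (x - y) • (1 : Matrix (Finset (Fin p) × Fin n) (Finset (Fin p) × Fin n) ℝ) =
        ((M : ClMatrix p n).block - y • 1) - ((M : ClMatrix p n).block - x • 1) := by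
      rw [sub_smul]; abel
    calc _ = clResolvent M x * (((M : ClMatrix p n).block - y • 1) -
          ((M : ClMatrix p n).block - x • 1)) * clResolvent M y := by
          rw [mul_sub, sub_mul, clResolvent_mul_block_sub_smul_one M hx, one_mul, mul_assoc,
            block_sub_smul_one_mul_clResolvent M hy, mul_one]
      _ = _ := by rw [← e, mul_smul_comm, mul_one, smul_mul_assoc]
  rw [← Matrix.trace_sub, h, Matrix.trace_smul, smul_eq_mul]

theorem eval_add_eq_det (t : ℝ) : (detPoly M).eval (x + t) =
    (((M : ClMatrix p n).block - x • 1) + t • (-1)).det := by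
  rw [detPoly_eval]
  congr 1
  rw [add_smul, smul_neg]; abel

/-- `trace U = -P' / P`. -/
theorem detPoly_derivative_eval (hx : (detPoly M).eval x ≠ 0) :
    (detPoly M).derivative.eval x = -((detPoly M).eval x * (clResolvent M x).trace) := by
  have h1 : HasDerivAt (fun t => (detPoly M).eval (x + t)) ((detPoly M).derivative.eval x) 0 := by
    simpa using! HasDerivAt.comp_const_add x 0 (by simpa using! (detPoly M).hasDerivAt (x + 0))
  have h2 := Matrix.hasDerivAt_det_add_smul ((M : ClMatrix p n).block - x • 1) (-1)
    (by rwa [← detPoly_eval])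
  simp only [← eval_add_eq_det] at h2
  rw [h1.unique h2, detPoly_eval, clResolvent]
  simp

/-- Equivalent to `trace (U²) = P'² / P² - P'' / P`. -/
theorem detPoly_derivative_derivative_eval (hx : (detPoly M).eval x ≠ 0) :
    (detPoly M).derivative.derivative.eval x = (detPoly M).eval x *
      ((clResolvent M x).trace ^ 2 - (clResolvent M x * clResolvent M x).trace) := by
  have hs : ∀ P : ℝ[X], HasDerivAt (fun t => P.eval (x + t)) (P.derivative.eval x) 0 := fun P => by
    simpa using! HasDerivAt.comp_const_add x 0 (by simpa using! P.hasDerivAt (x + 0))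
  have h2 := Matrix.hasDerivAt_trace_inv_add_smul_mul ((M : ClMatrix p n).block - x • 1) (-1) 1
    (by rwa [← detPoly_eval])
  have h3 := ((hs (detPoly M)).mul h2).neg
  have hev : ∀ᶠ t in nhds (0 : ℝ), (detPoly M).eval (x + t) ≠ 0 :=
    (hs (detPoly M)).continuousAt.eventually_ne (by simpa using hx)
  have h4 : (fun t => (detPoly M).derivative.eval (x + t)) =ᶠ[nhds 0]
      -((fun t => (detPoly M).eval (x + t)) *
        fun t => ((((M : ClMatrix p n).block - x • 1) + t • (-1))⁻¹ * 1).trace) := by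
    filter_upwards [hev] with t ht
    rw [detPoly_derivative_eval M ht]
    simp only [Pi.neg_apply, Pi.mul_apply, mul_one, clResolvent]
    congr 4
    rw [add_smul, smul_neg]; abel
  rw [(hs _).unique (h3.congr_of_eventuallyEq h4), detPoly_derivative_eval M hx]
  simp [clResolvent]
  ring

/-- Jacobi's formula for the directional derivatives of `P(x)`. -/
theorem fderiv_detPoly_eval (hx : (detPoly M).eval x ≠ 0) (v : ClSymm p n) :
    fderiv ℝ (fun N : ClSymm p n => (detPoly N).eval x) M v =
      (detPoly M).eval x * (clResolvent M x * (v : ClMatrix p n).block).trace := by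
  have hd := (contDiff_detPoly_eval (p := p) (n := n) x).contDiffAt.differentiableAt
    (x := M) two_ne_zero
  rw [← hd.lineDeriv_eq_fderiv]
  have h := Matrix.hasDerivAt_det_add_smul ((M : ClMatrix p n).block - x • 1)
    (v : ClMatrix p n).block (by rwa [← detPoly_eval])
  rw [lineDeriv, detPoly_eval, clResolvent, ← h.deriv]
  congr 1
  ext t
  rw [detPoly_eval, Submodule.coe_add, Submodule.coe_smul, ClMatrix.block_add,
    ClMatrix.block_smul]
  congr 1
  abel

theorem fderiv_fderiv_detPoly_eval (hx : (detPoly M).eval x ≠ 0) (v : ClSymm p n) :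
    fderiv ℝ (fun L => fderiv ℝ (fun N : ClSymm p n => (detPoly N).eval x) L v) M v =
      (detPoly M).eval x * ((clResolvent M x * (v : ClMatrix p n).block).trace ^ 2 -
        (clResolvent M x * (v : ClMatrix p n).block *
          (clResolvent M x * (v : ClMatrix p n).block)).trace) := by
  have hC := (contDiff_detPoly_eval (p := p) (n := n) x).contDiffAt (x := M)
  have hd := hC.differentiableAt_fderiv_apply v
  rw [← hd.lineDeriv_eq_fderiv, lineDeriv]
  have hb : ∀ t : ℝ, ((M + t • v : ClSymm p n) : ClMatrix p n).block - x • 1 =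
      ((M : ClMatrix p n).block - x • 1) + t • (v : ClMatrix p n).block := fun t => by
    rw [Submodule.coe_add, Submodule.coe_smul, ClMatrix.block_add, ClMatrix.block_smul]
    abel
  have h1 := Matrix.hasDerivAt_det_add_smul ((M : ClMatrix p n).block - x • 1)
    (v : ClMatrix p n).block (by rwa [← detPoly_eval])
  have h2 := Matrix.hasDerivAt_trace_inv_add_smul_mul ((M : ClMatrix p n).block - x • 1)
    (v : ClMatrix p n).block (v : ClMatrix p n).block (by rwa [← detPoly_eval])
  have h3 := h1.mul h2
  have hev : ∀ᶠ t in nhds (0 : ℝ),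
      (((M : ClMatrix p n).block - x • 1) + t • (v : ClMatrix p n).block).det ≠ 0 :=
    h1.continuousAt.eventually_ne (by simpa [← detPoly_eval] using hx)
  have h4 : (fun t : ℝ => fderiv ℝ (fun N : ClSymm p n => (detPoly N).eval x) (M + t • v) v)
      =ᶠ[nhds 0] (fun t : ℝ => (((M : ClMatrix p n).block - x • 1) +
        t • (v : ClMatrix p n).block).det) * fun t : ℝ => ((((M : ClMatrix p n).block - x • 1) +
        t • (v : ClMatrix p n).block)⁻¹ * (v : ClMatrix p n).block).trace := by
    filter_upwards [hev] with t ht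
    rw [← hb, ← detPoly_eval] at ht
    rw [fderiv_detPoly_eval _ ht, detPoly_eval, clResolvent, hb]
    rfl
  rw [(h3.congr_of_eventuallyEq h4).deriv, detPoly_eval]
  simp [clResolvent]
  ring

/-- `Γ(P(x), P(y)) = 2 ^ p P(x) P(y) trace (U(x) U(y))`. -/
theorem sum_fderiv_detPoly_eval {y : ℝ} (hx : (detPoly M).eval x ≠ 0)
    (hy : (detPoly M).eval y ≠ 0) :
    ∑ k, fderiv ℝ (fun N : ClSymm p n => (detPoly N).eval x) M
        (stdOrthonormalBasis ℝ (ClSymm p n) k) *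
      fderiv ℝ (fun N : ClSymm p n => (detPoly N).eval y) M
        (stdOrthonormalBasis ℝ (ClSymm p n) k) =
      2 ^ p * ((detPoly M).eval x * (detPoly M).eval y *
        (clResolvent M x * clResolvent M y).trace) := by
  obtain ⟨u, hu⟩ := exists_block_eq_clResolvent M hx
  obtain ⟨w, hw⟩ := exists_block_eq_clResolvent M hy
  have key : ∀ a b : ClSymm p n, ((a : ClMatrix p n).block * (b : ClMatrix p n).block).trace =
      2 ^ p * inner ℝ a b := fun a b => ClMatrix.trace_block_mul_block _ _ b.2
  simp only [fderiv_detPoly_eval M hx, fderiv_detPoly_eval M hy, ← hu, ← hw, key]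
  rw [← OrthonormalBasis.sum_inner_mul_inner (stdOrthonormalBasis ℝ (ClSymm p n)) u w]
  simp only [Finset.mul_sum]
  refine Finset.sum_congr rfl fun k _ => ?_
  rw [real_inner_comm w]
  ring

/-- `L(P)` is `P` times the sum, over an orthonormal basis, of `(trace U e)² - trace (U e U e)`. -/
theorem clLaplacian_detPoly_eval (hp : Even p) (hx : (detPoly M).eval x ≠ 0) :
    clLaplacian p n (fun N => (detPoly N).eval x) M = (detPoly M).eval x *
      (2 ^ p * (clResolvent M x * clResolvent M x).trace -
        1 / 2 * ((∑ A : Finset (Fin p), clSign A A) * (clResolvent M x * clResolvent M x).trace +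
          (clResolvent M x).trace ^ 2)) := by
  have hC := (contDiff_detPoly_eval (p := p) (n := n) x).contDiffAt (x := M)
  have h1 := sum_fderiv_detPoly_eval M hx hx
  simp only [fderiv_detPoly_eval M hx] at h1
  obtain ⟨u, hu⟩ := exists_block_eq_clResolvent M hx
  have h2 := ClMatrix.sum_trace_orthonormalBasis hp (stdOrthonormalBasis ℝ (ClSymm p n)) u u.2
  rw [hu] at h2
  rw [clLaplacian, hC.laplacian_eq_sum]
  simp only [fderiv_fderiv_detPoly_eval M hx]
  rw [← Finset.mul_sum, Finset.sum_sub_distrib, h2]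
  congr 2
  -- the sum of the `(trace U e)²` is known from `Γ(P(x), P(x))`
  have h3 : (detPoly M).eval x * (detPoly M).eval x ≠ 0 := mul_ne_zero hx hx
  refine mul_left_cancel₀ h3 ?_
  rw [Finset.mul_sum]
  refine Eq.trans (Finset.sum_congr rfl fun k _ => ?_) (h1.trans (by ring))
  ring

end Resolvent

/-! ### The carré du champ and the Laplacian on `P` -/

/-- A relation `(y - x) F(x, y) = G(x, y)`, polynomial in each variable, holds everywhere as soon
as it holds off the diagonal and off the roots of a nonzero polynomial. -/
theorem eq_of_forall_ne_of_eval_ne_zero {P : ℝ[X]} (hP : P ≠ 0) {F G : ℝ → ℝ → ℝ}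
    (hF₁ : ∀ y, ∃ D : ℝ[X], ∀ x, F x y = D.eval x) (hF₂ : ∀ x, ∃ D : ℝ[X], ∀ y, F x y = D.eval y)
    (hG₁ : ∀ y, ∃ D : ℝ[X], ∀ x, G x y = D.eval x) (hG₂ : ∀ x, ∃ D : ℝ[X], ∀ y, G x y = D.eval y)
    (h : ∀ x y, x ≠ y → P.eval x ≠ 0 → P.eval y ≠ 0 → F x y = G x y) (x y : ℝ) :
    F x y = G x y := by
  have step : ∀ {f g : ℝ → ℝ} (_ : ∃ D : ℝ[X], ∀ x, f x = D.eval x)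
      (_ : ∃ D : ℝ[X], ∀ x, g x = D.eval x) (z : ℝ)
      (_ : ∀ x, x ≠ z → P.eval x ≠ 0 → f x = g x), ∀ x, f x = g x := by
    rintro f g ⟨D, hD⟩ ⟨D', hD'⟩ z hfg x
    have : D = D' := by
      refine eq_of_eval_eq_of_eval_ne_zero (P := P * (X - C z))
        (mul_ne_zero hP (X_sub_C_ne_zero z)) fun x hx => ?_
      rw [eval_mul, eval_sub, eval_X, eval_C] at hx
      rw [← hD, ← hD']
      exact hfg x (sub_ne_zero.1 (right_ne_zero_of_mul hx)) (left_ne_zero_of_mul hx)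
    rw [hD, hD', this]
  have h1 : ∀ y, P.eval y ≠ 0 → ∀ x, F x y = G x y := fun y hy =>
    step (hF₁ y) (hG₁ y) y fun x hxy hx => h x y hxy hx hy
  exact step (hF₂ x) (hG₂ x) 0 (fun y _ hy => h1 y hy x) y

/-- The bracket `P'(x) P(y) - P'(y) P(x)` is polynomial in `x`. -/
theorem exists_eval_bracket (P : ℝ[X]) (c : ℝ) (y : ℝ) : ∃ D : ℝ[X], ∀ x,
    c * (P.derivative.eval x * P.eval y - P.derivative.eval y * P.eval x) = D.eval x :=
  ⟨C c * (P.derivative * C (P.eval y) - C (P.derivative.eval y) * P), fun x => by simp⟩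

section Family

open Laplacian

variable {E : Type*} [NormedAddCommGroup E] [InnerProductSpace ℝ E] [FiniteDimensional ℝ E]
  {F : E → ℝ[X]} {d : ℕ}

/-- The carré du champ formula for a family of polynomials extends from the pairs of non-roots
to all pairs. -/
theorem carreDuChamp_eval_family (hd : ∀ N, (F N).natDegree ≤ d)
    (hF : ∀ k, ContDiff ℝ 2 fun N => (F N).coeff k) (M : E) (hM : F M ≠ 0) (c : ℝ)
    (h : ∀ x y, x ≠ y → (F M).eval x ≠ 0 → (F M).eval y ≠ 0 →
      (y - x) * ∑ k, fderiv ℝ (fun N => (F N).eval x) M (stdOrthonormalBasis ℝ E k) *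
        fderiv ℝ (fun N => (F N).eval y) M (stdOrthonormalBasis ℝ E k) =
        c * ((F M).derivative.eval x * (F M).eval y - (F M).derivative.eval y * (F M).eval x))
    {x y : ℝ} (hxy : x ≠ y) :
    carreDuChamp Δ (fun N => (F N).eval x) (fun N => (F N).eval y) M =
      c / (y - x) *
        ((F M).derivative.eval x * (F M).eval y - (F M).derivative.eval y * (F M).eval x) := by
  choose D hD using fun k => exists_fderiv_eval_family hd hF M (stdOrthonormalBasis ℝ E k)
  rw [(contDiff_eval_family hd hF x).contDiffAt.carreDuChamp_eq_sum
    (contDiff_eval_family hd hF y).contDiffAt]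
  have hne : y - x ≠ 0 := sub_ne_zero.2 hxy.symm
  rw [div_mul_eq_mul_div, eq_div_iff hne, mul_comm _ (y - x)]
  refine eq_of_forall_ne_of_eval_ne_zero hM (F := fun x y => (y - x) *
    ∑ k, fderiv ℝ (fun N => (F N).eval x) M (stdOrthonormalBasis ℝ E k) *
        fderiv ℝ (fun N => (F N).eval y) M (stdOrthonormalBasis ℝ E k))
    (G := fun x y => c * ((F M).derivative.eval x * (F M).eval y -
      (F M).derivative.eval y * (F M).eval x)) ?_ ?_ (exists_eval_bracket _ c) ?_ h x y
  · exact fun y => ⟨(C y - X) * ∑ k, D k * C ((D k).eval y), fun x => by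
      simp [hD, eval_finsetSum]⟩
  · exact fun x => ⟨(X - C x) * ∑ k, C ((D k).eval x) * D k, fun y => by
      simp [hD, eval_finsetSum]⟩
  · intro x
    obtain ⟨D, hD⟩ := exists_eval_bracket (F M) (-c) x
    exact ⟨D, fun y => by rw [← hD]; ring⟩

end Family

theorem carreDuChamp_detPoly (M : ClSymm p n) {x y : ℝ} (hxy : x ≠ y) :
    carreDuChamp (clLaplacian p n)
        (fun N => (detPoly N).eval x) (fun N => (detPoly N).eval y) M =
      2 ^ p / (y - x) *
        ((detPoly M).derivative.eval x * (detPoly M).eval y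
          - (detPoly M).derivative.eval y * (detPoly M).eval x) := by
  refine carreDuChamp_eval_family (fun N => (natDegree_detPoly N).le) contDiff_coeff_detPoly M
    (detPoly_ne_zero M) (2 ^ p) (fun x y _ hx hy => ?_) hxy
  rw [sum_fderiv_detPoly_eval M hx hy, detPoly_derivative_eval M hx,
    detPoly_derivative_eval M hy]
  linear_combination (-(2 ^ p * (detPoly M).eval x * (detPoly M).eval y)) *
    trace_clResolvent_mul M hx hy

/-- `Γ(log P) = 2 ^ p trace (U(x)²)`. -/
theorem carreDuChamp_log_detPoly (M : ClSymm p n) {x : ℝ} (hx : (detPoly M).eval x ≠ 0) :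
    carreDuChamp (clLaplacian p n) (fun N => Real.log ((detPoly N).eval x))
      (fun N => Real.log ((detPoly N).eval x)) M =
      2 ^ p * (clResolvent M x * clResolvent M x).trace := by
  have hC := (contDiff_detPoly_eval (p := p) (n := n) x).contDiffAt (x := M)
  have hl : ContDiffAt ℝ 2 (fun N : ClSymm p n => Real.log ((detPoly N).eval x)) M := hC.log hx
  refine (hl.carreDuChamp_eq_sum hl).trans ?_
  have hd : ∀ v, fderiv ℝ (fun N : ClSymm p n => Real.log ((detPoly N).eval x)) M v =
      ((detPoly M).eval x)⁻¹ * fderiv ℝ (fun N : ClSymm p n => (detPoly N).eval x) M v := by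
    intro v
    rw [fderiv.log (hC.differentiableAt two_ne_zero) hx]
    simp
  have h := sum_fderiv_detPoly_eval M hx hx
  calc _ = ((detPoly M).eval x)⁻¹ * ((detPoly M).eval x)⁻¹ *
        ∑ k, fderiv ℝ (fun N : ClSymm p n => (detPoly N).eval x) M
          (stdOrthonormalBasis ℝ (ClSymm p n) k) *
        fderiv ℝ (fun N : ClSymm p n => (detPoly N).eval x) M
          (stdOrthonormalBasis ℝ (ClSymm p n) k) := by
        rw [Finset.mul_sum]
        exact Finset.sum_congr rfl fun k _ => by rw [hd]; ring
    _ = _ := by rw [h]; field_simp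

/-- The Laplacian on `P` for `p` even, in terms of `s = ∑_A (A|A)`. -/
theorem clLaplacian_detPoly_div (hp : Even p) (M : ClSymm p n) {x : ℝ}
    (hx : (detPoly M).eval x ≠ 0) :
    clLaplacian p n (fun N => (detPoly N).eval x) M / (detPoly M).eval x =
        carreDuChamp (clLaplacian p n)
            (fun N => Real.log ((detPoly N).eval x)) (fun N => Real.log ((detPoly N).eval x)) M
          - (∑ A : Finset (Fin p), clSign A A) / 2 * (clResolvent M x ^ 2).trace
          - 1 / 2 * (clResolvent M x).trace ^ 2 ∧
      clLaplacian p n (fun N => (detPoly N).eval x) M / (detPoly M).eval x =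
        (2 ^ p - (∑ A : Finset (Fin p), clSign A A) / 2) *
            ((detPoly M).derivative.eval x ^ 2 / (detPoly M).eval x ^ 2
              - (detPoly M).derivative.derivative.eval x / (detPoly M).eval x)
          - 1 / 2 * ((detPoly M).derivative.eval x ^ 2 / (detPoly M).eval x ^ 2) := by
  rw [carreDuChamp_log_detPoly M hx, clLaplacian_detPoly_eval M hp hx,
    detPoly_derivative_derivative_eval M hx, detPoly_derivative_eval M hx, sq (clResolvent M x)]
  constructor <;> field_simp <;> ring

/-! ### The carré du champ and the Laplacian on an `a`-th root of `P` -/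

theorem carreDuChamp_const_mul {V : Type*} (L : (V → ℝ) → V → ℝ) (c : ℝ) (f g : V → ℝ) (x : V) :
    carreDuChamp (fun f N => c * L f N) f g x = c * carreDuChamp L f g x := by
  unfold carreDuChamp; ring

section PowerRoot

-- the exponent `a`, which is positive, is written `b + 1`
variable {b : ℕ} {Q : ClSymm p n → ℝ[X]}

theorem natDegree_root_le (hQ : ∀ M, detPoly M = Q M ^ (b + 1)) (M : ClSymm p n) :
    (Q M).natDegree ≤ 2 ^ p * n := by
  have h := natDegree_detPoly M
  rw [hQ, natDegree_pow] at h
  nlinarith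

theorem root_ne_zero (hQ : ∀ M, detPoly M = Q M ^ (b + 1)) (M : ClSymm p n) : Q M ≠ 0 := by
  have h := detPoly_ne_zero M
  rw [hQ] at h
  exact ne_zero_pow (Nat.succ_ne_zero b) h

theorem fderiv_detPoly_eval_root (hc : ∀ k : ℕ, ContDiff ℝ 2 fun M => (Q M).coeff k)
    (hQ : ∀ M, detPoly M = Q M ^ (b + 1)) (M : ClSymm p n) (x : ℝ) (v : ClSymm p n) :
    fderiv ℝ (fun N : ClSymm p n => (detPoly N).eval x) M v =
      (b + 1) * (Q M).eval x ^ b * fderiv ℝ (fun N => (Q N).eval x) M v := by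
  have hd := (contDiff_eval_family (natDegree_root_le hQ) hc x).contDiffAt.differentiableAt
    (x := M) two_ne_zero
  simp only [hQ, eval_pow]
  rw [fderiv_fun_pow _ hd]
  simp

theorem sum_fderiv_detPoly_eval_root (hc : ∀ k : ℕ, ContDiff ℝ 2 fun M => (Q M).coeff k)
    (hQ : ∀ M, detPoly M = Q M ^ (b + 1)) (M : ClSymm p n) (x y : ℝ) :
    ∑ k, fderiv ℝ (fun N : ClSymm p n => (detPoly N).eval x) M
        (stdOrthonormalBasis ℝ (ClSymm p n) k) *
      fderiv ℝ (fun N : ClSymm p n => (detPoly N).eval y) M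
        (stdOrthonormalBasis ℝ (ClSymm p n) k) =
      (b + 1) ^ 2 * (Q M).eval x ^ b * (Q M).eval y ^ b *
      ∑ k, fderiv ℝ (fun N : ClSymm p n => (Q N).eval x) M
        (stdOrthonormalBasis ℝ (ClSymm p n) k) *
      fderiv ℝ (fun N : ClSymm p n => (Q N).eval y) M
        (stdOrthonormalBasis ℝ (ClSymm p n) k) := by
  simp only [fderiv_detPoly_eval_root hc hQ, Finset.mul_sum]
  exact Finset.sum_congr rfl fun k _ => by ring

theorem derivative_eval_root (hQ : ∀ M, detPoly M = Q M ^ (b + 1)) (M : ClSymm p n) (x : ℝ) :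
    (detPoly M).derivative.eval x = (b + 1) * (Q M).eval x ^ b * (Q M).derivative.eval x := by
  rw [hQ, derivative_pow]
  simp

theorem carreDuChamp_root (hc : ∀ k : ℕ, ContDiff ℝ 2 fun M => (Q M).coeff k)
    (hQ : ∀ M, detPoly M = Q M ^ (b + 1)) (M : ClSymm p n) {x y : ℝ} (hxy : x ≠ y) :
    carreDuChamp (fun f N => ((b + 1 : ℕ) : ℝ) / 2 ^ p * clLaplacian p n f N)
        (fun N => (Q N).eval x) (fun N => (Q N).eval y) M =
      1 / (y - x) *
        ((Q M).derivative.eval x * (Q M).eval y - (Q M).derivative.eval y * (Q M).eval x) := by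
  have hb : (b + 1 : ℝ) ≠ 0 := by positivity
  have h := carreDuChamp_eval_family (natDegree_root_le hQ) hc M (root_ne_zero hQ M)
    (2 ^ p / (b + 1)) (fun x y hxy hx hy => ?_) hxy
  · rw [carreDuChamp_const_mul]
    refine (congrArg _ h).trans ?_
    push_cast
    field_simp
  · have hP := carreDuChamp_detPoly M hxy
    have hne : y - x ≠ 0 := sub_ne_zero.2 hxy.symm
    have hC := contDiff_detPoly_eval (p := p) (n := n)
    have hs := ((hC x).contDiffAt (x := M)).carreDuChamp_eq_sum (hC y).contDiffAt
    rw [sum_fderiv_detPoly_eval_root hc hQ] at hs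
    have h2 := hs.symm.trans hP
    rw [derivative_eval_root hQ, derivative_eval_root hQ, hQ, eval_pow, eval_pow] at h2
    rw [div_mul_eq_mul_div, eq_div_iff hne] at h2
    have hk : (b + 1 : ℝ) * (Q M).eval x ^ b * (Q M).eval y ^ b ≠ 0 := by positivity
    refine mul_left_cancel₀ hk ?_
    rw [div_mul_eq_mul_div, mul_div_assoc', eq_div_iff hb]
    linear_combination h2

/-- The Laplacian on an `a`-th root of `P`. The condition `a² + a s = 2 ^ (p + 1)`, with
`s = ∑_A (A|A)`, is what makes the terms in `Q'² / Q` cancel. -/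
theorem clLaplacian_root (hp : Even p) (hc : ∀ k : ℕ, ContDiff ℝ 2 fun M => (Q M).coeff k)
    (hQ : ∀ M, detPoly M = Q M ^ (b + 1))
    (hs : (b + 1 : ℝ) ^ 2 + (b + 1) * ∑ A : Finset (Fin p), clSign A A = 2 * 2 ^ p)
    (M : ClSymm p n) (x : ℝ) :
    clLaplacian p n (fun N => (Q N).eval x) M =
      -((b + 1) / 2) * (Q M).derivative.derivative.eval x := by
  obtain ⟨D, hD⟩ := exists_laplacian_eval_family (natDegree_root_le hQ) hc M
  have hL : ∀ x, clLaplacian p n (fun N => (Q N).eval x) M = D.eval x := hD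
  have hb : (b + 1 : ℝ) ≠ 0 := by positivity
  have key : D = C (-((b + 1 : ℝ) / 2)) * (Q M).derivative.derivative := by
    refine eq_of_eval_eq_of_eval_ne_zero (root_ne_zero hQ M) fun x hx => ?_
    have hPx : (detPoly M).eval x ≠ 0 := by rw [hQ, eval_pow]; exact pow_ne_zero _ hx
    have hC := (contDiff_eval_family (natDegree_root_le hQ) hc x).contDiffAt (x := M)
    have h1 := detPoly_derivative_eval M hPx
    have h2 := detPoly_derivative_derivative_eval M hPx
    have h3 := sum_fderiv_detPoly_eval M hPx hPx
    have h4 := clLaplacian_detPoly_eval M hp hPx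
    rw [sum_fderiv_detPoly_eval_root hc hQ] at h3
    rw [derivative_eval_root hQ] at h1
    have hP : (detPoly M).eval x = (Q M).eval x ^ (b + 1) := by rw [hQ, eval_pow]
    have hpow : (fun N : ClSymm p n => (detPoly N).eval x) = fun N => (Q N).eval x ^ (b + 1) := by
      ext N; rw [hQ, eval_pow]
    have h5 : clLaplacian p n (fun N => (detPoly N).eval x) M * (Q M).eval x =
        (b + 1) * (Q M).eval x ^ (b + 1) * D.eval x + (b + 1) * b * (Q M).eval x ^ b *
        ∑ k, fderiv ℝ (fun N : ClSymm p n => (Q N).eval x) M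
          (stdOrthonormalBasis ℝ (ClSymm p n) k) *
        fderiv ℝ (fun N : ClSymm p n => (Q N).eval x) M
          (stdOrthonormalBasis ℝ (ClSymm p n) k) := by
      rw [← hL, hpow]
      cases b with
      | zero => simp [mul_comm]
      | succ m =>
        have := hC.laplacian_pow m
        rw [clLaplacian, this, ← clLaplacian.eq_def]
        push_cast; ring
    have h6 : (detPoly M).derivative.derivative.eval x * (Q M).eval x =
        (b + 1) * (Q M).eval x ^ (b + 1) * (Q M).derivative.derivative.eval x +
        (b + 1) * b * (Q M).eval x ^ b * (Q M).derivative.eval x ^ 2 := by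
      rw [hQ, derivative_pow]
      cases b with
      | zero => simp [mul_comm]
      | succ m =>
        simp [derivative_pow]
        ring
    rw [h2, hP] at h6
    rw [h4, hP] at h5
    rw [hP] at h1 h3
    rw [eval_mul, eval_C]
    generalize (clResolvent M x).trace = T₁ at *
    generalize (clResolvent M x * clResolvent M x).trace = T₂ at *
    generalize (∑ k, fderiv ℝ (fun N : ClSymm p n => (Q N).eval x) M
          (stdOrthonormalBasis ℝ (ClSymm p n) k) *
        fderiv ℝ (fun N : ClSymm p n => (Q N).eval x) M
          (stdOrthonormalBasis ℝ (ClSymm p n) k)) = S at *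
    generalize (∑ A : Finset (Fin p), clSign A A) = s at *
    generalize (Q M).eval x = Z at *
    generalize (Q M).derivative.eval x = Z₁ at *
    generalize (Q M).derivative.derivative.eval x = Z₂ at *
    generalize D.eval x = Λ at *
    have hZ : Z ^ b ≠ 0 := pow_ne_zero _ hx
    -- `Z`, `Z₁`, `Z₂` are the values of `Q`, `Q'`, `Q''`, and `T₁`, `T₂`, `S` are `trace U`,
    -- `trace (U²)`, `Γ(Q, Q)`; the latter are computed after cancelling powers of `Q`
    have e1 : Z * T₁ = -(b + 1) * Z₁ := mul_left_cancel₀ hZ (by linear_combination h1)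
    have e2 : Z ^ 2 * T₂ = (b + 1) * (Z₁ ^ 2 - Z * Z₂) := by
      have : Z ^ 2 * (T₁ ^ 2 - T₂) = (b + 1) * Z * Z₂ + (b + 1) * b * Z₁ ^ 2 :=
        mul_left_cancel₀ hZ (by linear_combination h6)
      linear_combination (Z * T₁ - (b + 1) * Z₁) * e1 - this
    have e3 : (b + 1) * S = 2 ^ p * (Z₁ ^ 2 - Z * Z₂) := by
      have : (b + 1 : ℝ) ^ 2 * S = 2 ^ p * (Z ^ 2 * T₂) :=
        mul_left_cancel₀ hZ (mul_left_cancel₀ hZ (by linear_combination h3))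
      refine mul_left_cancel₀ hb ?_
      linear_combination this + 2 ^ p * e2
    have e4 : Z ^ 2 * (2 ^ p * T₂ - 1 / 2 * (s * T₂ + T₁ ^ 2)) =
        (b + 1) * Z * Λ + (b + 1) * b * S := mul_left_cancel₀ hZ (by linear_combination h5)
    refine mul_left_cancel₀ (mul_ne_zero hb hx) ?_
    linear_combination -e4 + (2 ^ p - 1 / 2 * s) * e2 - b * e3 -
      1 / 2 * (Z * T₁ - (b + 1) * Z₁) * e1 - 1 / 2 * (Z₁ ^ 2 - Z * Z₂) * hs
  rw [hL, key, eval_mul, eval_C]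

end PowerRoot

end ClSymm

/-! ### Dimensions of representations of Clifford algebras -/

universe u

/-- A family of pairwise anticommuting endomorphisms with squares the scalars `s i`. -/
structure IsCliffordSystem {ι : Type*} (s : ι → ℝ) {V : Type u} [AddCommGroup V] [Module ℝ V]
    (g : ι → Module.End ℝ V) : Prop where
  mul_self : ∀ i, g i * g i = s i • 1
  anticomm : ∀ i j, i ≠ j → g i * g j = -(g j * g i)

theorem IsCliffordSystem.restrict {ι : Type*} {s : ι → ℝ} {V : Type u} [AddCommGroup V]
    [Module ℝ V] {g : ι → Module.End ℝ V} (h : IsCliffordSystem s g) (W : Submodule ℝ V)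
    (hW : ∀ i, ∀ x ∈ W, g i x ∈ W) :
    IsCliffordSystem s (fun i => (g i).restrict (hW i)) where
  mul_self i := by
    ext x
    simpa using LinearMap.congr_fun (h.mul_self i) x
  anticomm i j hij := by
    ext x
    simpa using LinearMap.congr_fun (h.anticomm i j hij) x

/-- `d` divides the dimension of every representation of the Clifford algebra with generators of
squares `s i`. -/
def CliffordDvd {ι : Type*} (s : ι → ℝ) (d : ℕ) : Prop :=
  ∀ (V : Type u) [AddCommGroup V] [Module ℝ V] [FiniteDimensional ℝ V] (g : ι → Module.End ℝ V),
    IsCliffordSystem s g → d ∣ Module.finrank ℝ V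

theorem CliffordDvd.of_injective {ι κ : Type*} {s : ι → ℝ} {s' : κ → ℝ} {d : ℕ}
    (h : CliffordDvd.{u} s' d) (φ : κ → ι) (hφ : φ.Injective) (hs : ∀ k, s (φ k) = s' k) :
    CliffordDvd.{u} s d := fun V _ _ _ g hg =>
  h V (g ∘ φ) ⟨fun k => by simp [hg.mul_self, hs], fun i j hij => hg.anticomm _ _ (hφ.ne hij)⟩

section Halving

variable {V : Type u} [AddCommGroup V] [Module ℝ V]

/-- A quaternionic structure makes the dimension divisible by `4`. -/
theorem four_dvd_finrank {J K : Module.End ℝ V} (hJ : J * J = -1) (hK : K * K = -1)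
    (hJK : J * K = -(K * J)) : 4 ∣ Module.finrank ℝ V := by
  let q : QuaternionAlgebra.Basis (Module.End ℝ V) (-1 : ℝ) 0 (-1) :=
    { i := J, j := K, k := J * K
      i_mul_i := by simp [hJ]
      j_mul_j := by simp [hK]
      i_mul_j := rfl
      j_mul_i := by simp [hJK] }
  let ρ : Quaternion ℝ →ₐ[ℝ] Module.End ℝ V := QuaternionAlgebra.lift q
  let _ : Module (Quaternion ℝ) V := Module.compHom V ρ.toRingHom
  have : IsScalarTower ℝ (Quaternion ℝ) V := ⟨fun r z v => by
    change ρ (r • z) v = r • ρ z v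
    simp⟩
  have h := Module.finrank_mul_finrank ℝ (Quaternion ℝ) V
  rw [Quaternion.finrank_eq_four] at h
  exact ⟨_, h.symm⟩

variable [FiniteDimensional ℝ V]

/-- An involution `T` that anticommutes with a complex structure `S` has eigenspaces of equal
dimension, as `S` exchanges them. -/
theorem finrank_eq_two_mul_finrank_ker {T S : Module.End ℝ V} (hT : T * T = 1) (hS : S * S = -1)
    (hTS : S * T = -(T * S)) :
    Module.finrank ℝ V = 2 * Module.finrank ℝ (LinearMap.ker (T - 1)) := by
  have hT' : ∀ x, T (T x) = x := fun x => by simpa using LinearMap.congr_fun hT x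
  have hS' : ∀ x, S (S x) = -x := fun x => by simpa using LinearMap.congr_fun hS x
  have hTS' : ∀ x, S (T x) = -T (S x) := fun x => by simpa using LinearMap.congr_fun hTS x
  have mem₁ : ∀ x, x ∈ LinearMap.ker (T - 1) ↔ T x = x := fun x => by simp [sub_eq_zero]
  have mem₂ : ∀ x, x ∈ LinearMap.ker (T + 1) ↔ T x = -x := fun x => by
    simp [add_eq_zero_iff_eq_neg]
  have hc : IsCompl (LinearMap.ker (T - 1)) (LinearMap.ker (T + 1)) := by
    constructor
    · rw [Submodule.disjoint_def]
      intro x h1 h2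
      rw [mem₁] at h1
      rw [mem₂, h1] at h2
      have h3 : (2 : ℝ) • x = 0 := by
        rw [two_smul]; nth_rewrite 1 [h2]; exact neg_add_cancel x
      exact (smul_eq_zero.1 h3).resolve_left two_ne_zero
    · rw [codisjoint_iff, Submodule.eq_top_iff']
      intro x
      refine Submodule.mem_sup.2 ⟨(1 / 2 : ℝ) • (x + T x), ?_, (1 / 2 : ℝ) • (x - T x), ?_, ?_⟩
      · rw [mem₁, map_smul, map_add, hT', add_comm]
      · rw [mem₂, map_smul, map_sub, hT', ← smul_neg, neg_sub]
      · rw [← smul_add, add_add_sub_cancel, ← two_smul ℝ x, smul_smul]; norm_num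
  let σ : V ≃ₗ[ℝ] V := LinearEquiv.ofLinearMap S (-S)
    (by ext x; simp [hS']) (by ext x; simp [hS'])
  have hmap : (LinearMap.ker (T - 1)).map (σ : V →ₗ[ℝ] V) = LinearMap.ker (T + 1) := by
    ext y
    rw [Submodule.mem_map, mem₂]
    constructor
    · rintro ⟨x, hx, rfl⟩
      rw [mem₁] at hx
      have := hTS' x
      rw [hx] at this
      exact neg_eq_iff_eq_neg.1 this.symm
    · intro hy
      refine ⟨-S y, ?_, ?_⟩
      · rw [mem₁, map_neg]
        have := hTS' y
        rw [hy, map_neg] at this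
        rw [← this]
      · change S (-S y) = y
        rw [map_neg, hS', neg_neg]
  rw [← Submodule.finrank_add_eq_of_isCompl hc, ← hmap, LinearEquiv.finrank_map_eq, two_mul]

end Halving

/-- Generators commuting with `T` restrict to the eigenspace of `T` for the eigenvalue `1`. -/
theorem IsCliffordSystem.restrict_ker {ι : Type*} {s : ι → ℝ} {V : Type u} [AddCommGroup V]
    [Module ℝ V] {g : ι → Module.End ℝ V} (h : IsCliffordSystem s g) {T : Module.End ℝ V}
    (hT : ∀ i, T * g i = g i * T) :
    ∃ g' : ι → Module.End ℝ (LinearMap.ker (T - 1)), IsCliffordSystem s g' :=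
  ⟨_, h.restrict _ fun i x hx => by
    have h1 : T x = x := by simpa [sub_eq_zero] using hx
    have h2 : T (g i x) = g i (T x) := by simpa using LinearMap.congr_fun (hT i) x
    simp [h2, h1]⟩

/-- A pair of generators `e`, `f` of opposite squares doubles the dimension: `e f` is an involution
commuting with the other generators, and `e` exchanges its eigenspaces. -/
theorem CliffordDvd.sum_pair {ι : Type*} {s : ι → ℝ} {d : ℕ} (h : CliffordDvd.{u} s d) :
    CliffordDvd.{u} (Sum.elim s ![-1, 1]) (2 * d) := fun V _ _ _ g hg => by
  set e := g (Sum.inr 0)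
  set f := g (Sum.inr 1)
  have he : e * e = -1 := by simpa using hg.mul_self (Sum.inr 0)
  have hf : f * f = 1 := by simpa using hg.mul_self (Sum.inr 1)
  have hef : e * f = -(f * e) := hg.anticomm _ _ (by simp)
  have hsub : IsCliffordSystem s (fun i => g (Sum.inl i)) :=
    ⟨fun i => hg.mul_self _, fun i j hij => hg.anticomm _ _ (by simpa using hij)⟩
  have hT : (e * f) * (e * f) = 1 := by
    linear_combination (norm := noncomm_ring) e * hef * f - he * (f * f) + hf
  obtain ⟨g', hg'⟩ := hsub.restrict_ker (T := e * f) fun i => by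
    have h1 : e * g (Sum.inl i) = -(g (Sum.inl i) * e) := hg.anticomm _ _ (by simp)
    have h2 : f * g (Sum.inl i) = -(g (Sum.inl i) * f) := hg.anticomm _ _ (by simp)
    rw [mul_assoc, h2, mul_neg, ← mul_assoc, h1, neg_mul, neg_neg, mul_assoc]
  rw [finrank_eq_two_mul_finrank_ker hT he (by
    linear_combination (norm := noncomm_ring) e * hef)]
  exact Nat.mul_dvd_mul_left 2 (h _ g' hg')

theorem CliffordDvd.sum_pairs {ι : Type*} {s : ι → ℝ} {d : ℕ} (h : CliffordDvd.{u} s d) (k : ℕ) :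
    CliffordDvd.{u} (Sum.elim (Sum.elim s fun _ : Fin k => -1) fun _ : Fin k => 1)
      (2 ^ k * d) := by
  induction k with
  | zero =>
    rw [pow_zero, one_mul]
    exact h.of_injective (fun i => Sum.inl (Sum.inl i)) (fun i j hij => by simpa using hij)
      fun _ => rfl
  | succ k ih =>
    rw [pow_succ', mul_assoc]
    refine ih.sum_pair.of_injective (Sum.elim (Sum.map (Sum.map id Fin.castSucc) Fin.castSucc)
      ![Sum.inl (Sum.inr (Fin.last k)), Sum.inr (Fin.last k)]) ?_ ?_
    · have hne : ∀ i : Fin k, i.castSucc ≠ Fin.last k := fun i => (Fin.castSucc_lt_last i).ne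
      rintro (((i | i) | i) | i) (((j | j) | j) | j)
      all_goals try fin_cases i
      all_goals try fin_cases j
      all_goals simp [hne, (hne _).symm]
    · rintro (((i | i) | i) | i)
      all_goals try fin_cases i
      all_goals simp

section Twist

variable {R : Type*} [Ring R] {a b c d x : R}

theorem commute_mul_four (ha : x * a = -(a * x)) (hb : x * b = -(b * x)) (hc : x * c = -(c * x))
    (hd : x * d = -(d * x)) : x * (a * b * c * d) = a * b * c * d * x := by
  linear_combination (norm := noncomm_ring)
    ha * b * c * d - a * hb * c * d + a * b * hc * d - a * b * c * hd

theorem mul_four_mul_self (hab : b * a = -(a * b)) (hac : c * a = -(a * c))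
    (had : d * a = -(a * d)) (hbc : c * b = -(b * c)) (hbd : d * b = -(b * d))
    (hcd : d * c = -(c * d)) (ha : a * a = -1) (hb : b * b = -1) (hc : c * c = -1)
    (hd : d * d = -1) : a * b * c * d * (a * b * c * d) = 1 := by
  have h1 : c * d * (c * d) = -1 := by
    linear_combination (norm := noncomm_ring) c * hcd * d - hc * d * d + hd
  have h2 : b * c * d * (b * c * d) = 1 := by
    linear_combination (norm := noncomm_ring)
      b * c * hbd * c * d - b * hbc * d * c * d + hb * c * d * c * d - h1
  linear_combination (norm := noncomm_ring)
    a * b * c * had * b * c * d - a * b * hac * d * b * c * d + a * hab * c * d * b * c * d -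
      ha * b * c * d * b * c * d + h2

/-- Each of four anticommuting elements anticommutes with their product. -/
theorem anticomm_mul_four {e : Fin 4 → R} (hee : ∀ k l, k ≠ l → e k * e l = -(e l * e k))
    (k : Fin 4) : e k * (e 0 * e 1 * e 2 * e 3) = -(e 0 * e 1 * e 2 * e 3 * e k) := by
  have h10 := hee 1 0 (by decide)
  have h20 := hee 2 0 (by decide)
  have h30 := hee 3 0 (by decide)
  have h21 := hee 2 1 (by decide)
  have h31 := hee 3 1 (by decide)
  have h32 := hee 3 2 (by decide)
  fin_cases k
  · change e 0 * (e 0 * e 1 * e 2 * e 3) = -(e 0 * e 1 * e 2 * e 3 * e 0)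
    linear_combination (norm := noncomm_ring) e 0 * h10 * e 2 * e 3 - e 0 * e 1 * h20 * e 3 +
      e 0 * e 1 * e 2 * h30
  · change e 1 * (e 0 * e 1 * e 2 * e 3) = -(e 0 * e 1 * e 2 * e 3 * e 1)
    linear_combination (norm := noncomm_ring) h10 * e 1 * e 2 * e 3 - e 0 * e 1 * h21 * e 3 +
      e 0 * e 1 * e 2 * h31
  · change e 2 * (e 0 * e 1 * e 2 * e 3) = -(e 0 * e 1 * e 2 * e 3 * e 2)
    linear_combination (norm := noncomm_ring) h20 * e 1 * e 2 * e 3 - e 0 * h21 * e 2 * e 3 +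
      e 0 * e 1 * e 2 * h32
  · change e 3 * (e 0 * e 1 * e 2 * e 3) = -(e 0 * e 1 * e 2 * e 3 * e 3)
    linear_combination (norm := noncomm_ring) h30 * e 1 * e 2 * e 3 - e 0 * h31 * e 2 * e 3 +
      e 0 * e 1 * h32 * e 3

end Twist

/-- Multiplying four generators of square `-1` by their product turns their squares into `1`. -/
theorem CliffordDvd.twist {ι : Type*} {s : ι → ℝ} {d : ℕ}
    (h : CliffordDvd.{u} (Sum.elim s fun _ : Fin 4 => 1) d) :
    CliffordDvd.{u} (Sum.elim s fun _ : Fin 4 => -1) d := fun V _ _ _ g hg => by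
  set e : Fin 4 → Module.End ℝ V := fun k => g (Sum.inr k) with he_def
  set ω := e 0 * e 1 * e 2 * e 3 with hω_def
  have he : ∀ k, e k * e k = -1 := fun k => by simpa using hg.mul_self (Sum.inr k)
  have hee : ∀ k l, k ≠ l → e k * e l = -(e l * e k) := fun k l hkl =>
    hg.anticomm _ _ (by simpa using hkl)
  have hge : ∀ i k, g (Sum.inl i) * e k = -(e k * g (Sum.inl i)) := fun i k =>
    hg.anticomm _ _ (by simp)
  have hgω : ∀ i, g (Sum.inl i) * ω = ω * g (Sum.inl i) := fun i =>
    commute_mul_four (hge i 0) (hge i 1) (hge i 2) (hge i 3)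
  have hω : ω * ω = 1 := mul_four_mul_self (hee _ _ (by decide)) (hee _ _ (by decide))
    (hee _ _ (by decide)) (hee _ _ (by decide)) (hee _ _ (by decide)) (hee _ _ (by decide))
    (he 0) (he 1) (he 2) (he 3)
  have heω : ∀ k, e k * ω = -(ω * e k) := anticomm_mul_four hee
  refine h V (Sum.elim (fun i => g (Sum.inl i)) fun k => e k * ω) ⟨?_, ?_⟩
  · rintro (i | k)
    · exact hg.mul_self (Sum.inl i)
    · simp only [Sum.elim_inr, one_smul]
      linear_combination (norm := noncomm_ring) e k * heω k * ω - he k * (ω * ω) + hω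
  · rintro (i | k) (j | l) hij
    · exact hg.anticomm _ _ hij
    · simp only [Sum.elim_inl, Sum.elim_inr]
      linear_combination (norm := noncomm_ring) hge i l * ω - e l * hgω i
    · simp only [Sum.elim_inl, Sum.elim_inr]
      linear_combination (norm := noncomm_ring) hge j k * ω - e k * hgω j
    · simp only [Sum.elim_inr]
      have hkl := hee k l (by simpa using hij)
      linear_combination (norm := noncomm_ring) e k * heω l * ω + e l * heω k * ω - hkl * ω * ω

theorem cliffordDvd_zero : CliffordDvd.{u} (fun _ : Fin 0 => (-1 : ℝ)) 1 :=
  fun _ _ _ _ _ _ => one_dvd _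

theorem cliffordDvd_two : CliffordDvd.{u} (fun _ : Fin 2 => (-1 : ℝ)) 4 := fun V _ _ _ g hg =>
  four_dvd_finrank (by simpa using hg.mul_self 0) (by simpa using hg.mul_self 1)
    (hg.anticomm 0 1 (by decide))

/-- The product of the four generators is an involution whose eigenspaces are exchanged by the
generators, and `e₀ e₁`, `e₀ e₂` define a quaternionic structure on them. -/
theorem cliffordDvd_four : CliffordDvd.{u} (fun _ : Fin 4 => (-1 : ℝ)) 8 := fun V _ _ _ g hg => by
  have he : ∀ k, g k * g k = -1 := fun k => by simpa using hg.mul_self k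
  have h10 := hg.anticomm 1 0 (by decide)
  have h20 := hg.anticomm 2 0 (by decide)
  have h30 := hg.anticomm 3 0 (by decide)
  have h21 := hg.anticomm 2 1 (by decide)
  have h31 := hg.anticomm 3 1 (by decide)
  have h32 := hg.anticomm 3 2 (by decide)
  have hω := mul_four_mul_self h10 h20 h30 h21 h31 h32 (he 0) (he 1) (he 2) (he 3)
  have hJ : IsCliffordSystem (fun _ : Fin 2 => (-1 : ℝ)) ![g 0 * g 1, g 0 * g 2] := by
    refine ⟨fun i => ?_, fun i j hij => ?_⟩
    · fin_cases i
      · simp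
        linear_combination (norm := noncomm_ring) g 0 * h10 * g 1 - he 0 * (g 1 * g 1) + he 1
      · simp
        linear_combination (norm := noncomm_ring) g 0 * h20 * g 2 - he 0 * (g 2 * g 2) + he 2
    · have : g 0 * g 1 * (g 0 * g 2) = -(g 0 * g 2 * (g 0 * g 1)) := by
        linear_combination (norm := noncomm_ring) g 0 * h10 * g 2 + g 0 * h20 * g 1 -
          g 0 * g 0 * h21
      fin_cases i <;> fin_cases j <;> simp_all
  obtain ⟨g', hg'⟩ := hJ.restrict_ker (T := g 0 * g 1 * g 2 * g 3) fun i => by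
    have h0 := anticomm_mul_four hg.anticomm 0
    fin_cases i
    · change g 0 * g 1 * g 2 * g 3 * (g 0 * g 1) = g 0 * g 1 * (g 0 * g 1 * g 2 * g 3)
      linear_combination (norm := noncomm_ring) h0 * g 1 - g 0 * anticomm_mul_four hg.anticomm 1
    · change g 0 * g 1 * g 2 * g 3 * (g 0 * g 2) = g 0 * g 2 * (g 0 * g 1 * g 2 * g 3)
      linear_combination (norm := noncomm_ring) h0 * g 2 - g 0 * anticomm_mul_four hg.anticomm 2
  rw [finrank_eq_two_mul_finrank_ker hω (he 0) (anticomm_mul_four hg.anticomm 0)]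
  exact Nat.mul_dvd_mul_left 2 (cliffordDvd_two _ g' hg')

/-- For two generators of square `1`, their product is a complex structure that exchanges the
eigenspaces of either. -/
theorem cliffordDvd_two_one : CliffordDvd.{u} (fun _ : Fin 2 => (1 : ℝ)) 2 := fun V _ _ _ g hg => by
  have h0 : g 0 * g 0 = 1 := by simpa using hg.mul_self 0
  have h1 : g 1 * g 1 = 1 := by simpa using hg.mul_self 1
  have h01 := hg.anticomm 0 1 (by decide)
  rw [finrank_eq_two_mul_finrank_ker h0 (S := g 0 * g 1)
    (by linear_combination (norm := noncomm_ring) g 0 * h01 * g 1 - h0 * (g 1 * g 1) - h1)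
    (by linear_combination (norm := noncomm_ring) g 0 * h01)]
  exact dvd_mul_right _ _

/-- Twisting four of six generators leaves two of square `-1` and four of square `1`; two pairs
split off, and two generators of square `1` remain. -/
theorem cliffordDvd_six : CliffordDvd.{u} (fun _ : Fin 6 => (-1 : ℝ)) 8 := by
  have h := (cliffordDvd_two_one.sum_pairs 2)
  have h2 : CliffordDvd.{u} (Sum.elim (fun _ : Fin 2 => (-1 : ℝ)) fun _ : Fin 4 => 1) 8 :=
    h.of_injective (Sum.elim (Sum.elim (fun i => Sum.inr (Fin.natAdd 2 i)) Sum.inl)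
      fun i => Sum.inr (Fin.castAdd 2 i)) (by
        rintro ((i | i) | i) ((j | j) | j) <;> revert i j <;> decide)
      (by rintro ((i | i) | i) <;> rfl)
  exact h2.twist.of_injective (Sum.elim (Fin.castAdd 4) (Fin.natAdd 2))
    (by rintro (i | i) (j | j) <;> revert i j <;> decide) (by rintro (i | i) <;> rfl)

/-- Bott periodicity: eight more generators multiply the dimensions by `16`. -/
theorem CliffordDvd.add_eight {p d : ℕ} (h : CliffordDvd.{u} (fun _ : Fin p => (-1 : ℝ)) d) :
    CliffordDvd.{u} (fun _ : Fin (p + 8) => (-1 : ℝ)) (2 ^ 4 * d) :=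
  (h.sum_pairs 4).twist.of_injective (Sum.elim (Sum.elim (fun i => Fin.castAdd 8 i)
      fun i => Fin.natAdd p (Fin.castAdd 4 i)) fun i => Fin.natAdd p (Fin.natAdd 4 i))
    (by
      rintro ((i | i) | i) ((j | j) | j) hij <;> simp [Fin.ext_iff] at hij ⊢ <;> omega)
    (by rintro ((i | i) | i) <;> rfl)

theorem CliffordDvd.add_eight_mul {p d : ℕ} (h : CliffordDvd.{u} (fun _ : Fin p => (-1 : ℝ)) d)
    (q : ℕ) : CliffordDvd.{u} (fun _ : Fin (8 * q + p) => (-1 : ℝ)) (2 ^ (4 * q) * d) := by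
  induction q with
  | zero =>
    have e : 8 * 0 + p = p := by ring
    rw [e]; simpa using h
  | succ q ih =>
    have e : 8 * (q + 1) + p = 8 * q + p + 8 := by ring
    have e' : 2 ^ (4 * (q + 1)) * d = 2 ^ 4 * (2 ^ (4 * q) * d) := by ring
    rw [e, e']
    exact ih.add_eight

/-- The dimension of a representation of `Cl(E)`, for `p` even, is divisible by `a`. -/
theorem cliffordDvd_of_even {p q a : ℕ}
    (h : (p = 8 * q ∧ a = 2 ^ (4 * q)) ∨ (p = 8 * q + 2 ∧ a = 2 ^ (4 * q + 2)) ∨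
        (p = 8 * q + 4 ∧ a = 2 ^ (4 * q + 3)) ∨ (p = 8 * q + 6 ∧ a = 2 ^ (4 * q + 3))) :
    CliffordDvd.{u} (fun _ : Fin p => (-1 : ℝ)) a := by
  rcases h with ⟨rfl, rfl⟩ | ⟨rfl, rfl⟩ | ⟨rfl, rfl⟩ | ⟨rfl, rfl⟩
  · simpa using cliffordDvd_zero.add_eight_mul q
  · simpa [pow_add] using cliffordDvd_two.add_eight_mul q
  · simpa [pow_add] using cliffordDvd_four.add_eight_mul q
  · simpa [pow_add] using cliffordDvd_six.add_eight_mul q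

/-! ### Roots of polynomials in families -/

section PolyRoot

variable {R : Type*} [CommRing R]

/-- For monic `A`, `B` of degree `N`, the factor `S = ∑ AⁱBᵇ⁻ⁱ` of `Aᵇ⁺¹ - Bᵇ⁺¹ = (A - B) S` has
degree at most `b N`, and its coefficient of that degree is `b + 1`. -/
theorem coeff_sum_pow_mul_pow {A B : R[X]} {N : ℕ} (hA : A.Monic) (hB : B.Monic)
    (hAN : A.natDegree = N) (hBN : B.natDegree = N) (b m : ℕ) (hm : b * N ≤ m) :
    (∑ i ∈ Finset.range (b + 1), A ^ i * B ^ (b + 1 - 1 - i)).coeff m =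
      if m = b * N then (b + 1 : R) else 0 := by
  have h : ∀ i ∈ Finset.range (b + 1), (A ^ i * B ^ (b + 1 - 1 - i)).coeff m =
      if m = b * N then (1 : R) else 0 := by
    intro i hi
    have hi' : i ≤ b := Nat.lt_succ_iff.1 (Finset.mem_range.1 hi)
    have hmon : (A ^ i * B ^ (b + 1 - 1 - i)).Monic := (hA.pow i).mul (hB.pow _)
    have hdeg : (A ^ i * B ^ (b + 1 - 1 - i)).natDegree = b * N := by
      rw [(hA.pow i).natDegree_mul (hB.pow _), hA.natDegree_pow, hB.natDegree_pow, hAN, hBN,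
        ← add_mul]
      congr 1
      omega
    split_ifs with hmb
    · rw [hmb, ← hdeg]; exact hmon.coeff_natDegree
    · exact coeff_eq_zero_of_natDegree_lt (by rw [hdeg]; omega)
  rw [finsetSum_coeff, Finset.sum_congr rfl h]
  simp

/-- A monic polynomial of degree `(b + 1) N` agrees with a `(b + 1)`-th power in its `k + 1` leading
coefficients, which are corrected one at a time. -/
theorem exists_monic_pow_close [Nontrivial R] {c : R} {b N : ℕ} (hc : (b + 1 : R) * c = 1)
    {P : R[X]} (hP : P.Monic) (hPN : P.natDegree = (b + 1) * N) (k : ℕ) (hk : k ≤ N) :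
    ∃ Q : R[X], Q.Monic ∧ Q.natDegree = N ∧
      ∀ m, b * N + (N - k) ≤ m → (P - Q ^ (b + 1)).coeff m = 0 := by
  induction k with
  | zero =>
    refine ⟨X ^ N, monic_X_pow N, natDegree_X_pow N, fun m hm => ?_⟩
    rcases hm.eq_or_lt with rfl | hlt
    · have e : b * N + (N - 0) = (b + 1) * N := by rw [Nat.sub_zero]; ring
      rw [e, coeff_sub, ← pow_mul, mul_comm N, coeff_X_pow_self, ← hPN, hP.coeff_natDegree,
        sub_self]
    · have e : (b + 1) * N < m := by rw [Nat.sub_zero] at hlt; linarith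
      rw [coeff_sub, coeff_eq_zero_of_natDegree_lt (by rwa [hPN]), ← pow_mul, mul_comm N,
        coeff_X_pow, if_neg e.ne', sub_self]
  | succ k ih =>
    obtain ⟨Q, hQ, hQN, h⟩ := ih (Nat.le_of_succ_le hk)
    set j := N - (k + 1) with hj
    have hjN : j < N := by omega
    -- the correction `t X ^ j` changes the coefficient of `Q ^ (b + 1)` in degree `b N + j` by
    -- `(b + 1) t`, and none above
    set t : R := c * (P - Q ^ (b + 1)).coeff (b * N + j)
    have hlt : (C t * X ^ j).degree < Q.degree := by
      refine (degree_C_mul_X_pow_le j t).trans_lt ?_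
      rw [degree_eq_natDegree hQ.ne_zero, hQN]
      exact_mod_cast hjN
    have hQ' : (Q + C t * X ^ j).Monic := hQ.add_of_left hlt
    have hQN' : (Q + C t * X ^ j).natDegree = N := by
      rw [natDegree_add_eq_left_of_degree_lt hlt, hQN]
    refine ⟨Q + C t * X ^ j, hQ', hQN', fun m hm => ?_⟩
    have hgeom := (Commute.all (Q + C t * X ^ j) Q).mul_geom_sum₂ (b + 1)
    rw [add_sub_cancel_left] at hgeom
    have e : P - (Q + C t * X ^ j) ^ (b + 1) = (P - Q ^ (b + 1)) - C t * (X ^ j *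
        ∑ i ∈ Finset.range (b + 1), (Q + C t * X ^ j) ^ i * Q ^ (b + 1 - 1 - i)) := by
      rw [← mul_assoc, hgeom]; ring
    rw [e, coeff_sub, coeff_C_mul, coeff_X_pow_mul', if_pos (by omega),
      coeff_sum_pow_mul_pow hQ' hQ hQN' hQN b _ (by omega)]
    split_ifs with hmj
    · have : m = b * N + j := by omega
      rw [this]
      linear_combination (-(P - Q ^ (b + 1)).coeff (b * N + j)) * hc
    · rw [h m (by omega), mul_zero, sub_zero]

/-- The `(b + 1)`-th root at infinity of a monic polynomial of degree `(b + 1) N`: its polynomial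
part, determined by the leading coefficients. -/
theorem exists_monic_root_at_infinity [Nontrivial R] {c : R} {b N : ℕ} (hc : (b + 1 : R) * c = 1)
    {P : R[X]} (hP : P.Monic) (hPN : P.natDegree = (b + 1) * N) :
    ∃ Q : R[X], Q.Monic ∧ Q.natDegree = N ∧
      ∀ m, b * N ≤ m → (P - Q ^ (b + 1)).coeff m = 0 := by
  simpa using exists_monic_pow_close hc hP hPN N le_rfl

/-- The root at infinity is unique. -/
theorem eq_of_pow_sub_pow_small [IsDomain R] {b N : ℕ} (hb : (b + 1 : R) ≠ 0) {A B : R[X]}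
    (hA : A.Monic) (hB : B.Monic) (hAN : A.natDegree = N) (hBN : B.natDegree = N)
    (h : ∀ m, b * N ≤ m → (A ^ (b + 1) - B ^ (b + 1)).coeff m = 0) : A = B := by
  by_contra hne
  have hgeom := (Commute.all A B).mul_geom_sum₂ (b + 1)
  set S := ∑ i ∈ Finset.range (b + 1), A ^ i * B ^ (b + 1 - 1 - i) with hS
  have hSc : S.coeff (b * N) ≠ 0 := by
    rw [hS, coeff_sum_pow_mul_pow hA hB hAN hBN b _ le_rfl, if_pos rfl]; exact hb
  have hS0 : S ≠ 0 := fun h0 => hSc (by rw [h0, coeff_zero])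
  have hprod : (A - B) * S ≠ 0 := mul_ne_zero (sub_ne_zero.2 hne) hS0
  refine leadingCoeff_ne_zero.2 hprod ?_
  rw [leadingCoeff, hgeom]
  refine h _ ?_
  rw [← hgeom, natDegree_mul (sub_ne_zero.2 hne) hS0]
  exact (le_natDegree_of_ne_zero hSc).trans (Nat.le_add_left _ _)

end PolyRoot

/-- A split monic polynomial whose root multiplicities are divisible by `a` is an `a`-th power. -/
theorem exists_monic_pow_eq_of_dvd_rootMultiplicity {K : Type*} [Field K] {P : K[X]} {a : ℕ}
    (hP : P.Monic) (hs : P.Splits) (h : ∀ r, a ∣ P.rootMultiplicity r) :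
    ∃ Q : K[X], Q.Monic ∧ P = Q ^ a := by
  classical
  refine ⟨∏ r ∈ P.roots.toFinset, (X - C r) ^ (P.roots.count r / a),
    monic_prod_of_monic _ _ fun r _ => (monic_X_sub_C r).pow _, ?_⟩
  conv_lhs => rw [hs.eq_prod_roots_of_monic hP]
  rw [Finset.prod_multiset_map_count, ← Finset.prod_pow]
  refine Finset.prod_congr rfl fun r _ => ?_
  rw [← pow_mul, Nat.div_mul_cancel (by rw [count_roots]; exact h r)]

section PowerOfRoot

variable {p n : ℕ}

/-! ### The determinant as a perfect power -/

/-- The generalized eigenspaces of a left multiplication are stable under the right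
multiplications, hence are representations of `Cl(E)`. -/
theorem dvd_rootMultiplicity_charpoly_block {a : ℕ}
    (h : CliffordDvd.{0} (fun _ : Fin p => (-1 : ℝ)) a) (M : ClMatrix p n) (r : ℝ) :
    a ∣ M.block.charpoly.rootMultiplicity r := by
  rw [← Matrix.charpoly_toLin', ← LinearMap.finrank_maxGenEigenspace_eq]
  have hsys : IsCliffordSystem (fun _ : Fin p => (-1 : ℝ))
      fun k => Matrix.toLin' (ClMatrix.rightMul n {k}) :=
    ⟨fun k => by
      rw [Module.End.mul_eq_comp, ← Matrix.toLin'_mul, ClMatrix.rightMul_singleton_mul_self,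
        map_neg, Matrix.toLin'_one]
      exact (neg_one_smul ℝ _).symm,
    fun k l hkl => by
      rw [Module.End.mul_eq_comp, Module.End.mul_eq_comp, ← Matrix.toLin'_mul, ← Matrix.toLin'_mul,
        ClMatrix.rightMul_singleton_anticomm hkl, map_neg]⟩
  refine h _ _ (hsys.restrict _ fun k => Module.End.mapsTo_maxGenEigenspace_of_comm ?_ r)
  rw [Commute, SemiconjBy, Module.End.mul_eq_comp, Module.End.mul_eq_comp, ← Matrix.toLin'_mul,
    ← Matrix.toLin'_mul, (ClMatrix.commute_block_rightMul M {k}).eq]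

/-- The block matrix is real symmetric, so its characteristic polynomial splits. -/
theorem exists_charpoly_block_eq_pow {a : ℕ}
    (h : CliffordDvd.{0} (fun _ : Fin p => (-1 : ℝ)) a) (M : ClSymm p n) :
    ∃ Q : ℝ[X], Q.Monic ∧ (M : ClMatrix p n).block.charpoly = Q ^ a := by
  have hH : (M : ClMatrix p n).block.IsHermitian := by
    have : (M : ClMatrix p n).block.IsSymm := M.2
    rw [Matrix.IsHermitian, Matrix.conjTranspose_eq_transpose_of_trivial, this.eq]
  exact exists_monic_pow_eq_of_dvd_rootMultiplicity (Matrix.charpoly_monic _) hH.splits_charpoly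
    (dvd_rootMultiplicity_charpoly_block h _)

/-- The `a`-th root of `P` depends polynomially on the entries: the root at infinity of the
generic characteristic polynomial specializes to the root of each characteristic polynomial. -/
theorem exists_generic_root {b : ℕ}
    (h : CliffordDvd.{0} (fun _ : Fin p => (-1 : ℝ)) (b + 1))
    (hsign : ((-1 : ℝ) ^ (2 ^ p * n)) ^ (b + 1) = (-1) ^ (2 ^ p * n)) :
    ∃ Q : (MvPolynomial (Finset (Fin p) × Fin n × Fin n) ℝ)[X], ∀ M : ClSymm p n,
      detPoly M = Q.map (MvPolynomial.eval fun s => (M : ClMatrix p n) s) ^ (b + 1) := by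
  have hb : (b + 1 : ℝ) ≠ 0 := by positivity
  have hdeg : ∀ (M : ClSymm p n) (Q : ℝ[X]), (M : ClMatrix p n).block.charpoly = Q ^ (b + 1) →
      (b + 1) * Q.natDegree = 2 ^ p * n := fun M Q hQ => by
    rw [← natDegree_pow, ← hQ, Matrix.charpoly_natDegree_eq_dim, card_block_index]
  obtain ⟨Q₀, -, hQ₀⟩ := exists_charpoly_block_eq_pow h (0 : ClSymm p n)
  set N := Q₀.natDegree with hN
  have hN' : (b + 1) * N = 2 ^ p * n := hdeg _ _ hQ₀
  obtain ⟨Q, hQ, hQN, hQP⟩ := exists_monic_root_at_infinity (b := b) (N := N)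
    (c := MvPolynomial.C ((b + 1 : ℝ)⁻¹))
    (by
      have : (b + 1 : MvPolynomial (Finset (Fin p) × Fin n × Fin n) ℝ) =
        MvPolynomial.C (b + 1 : ℝ) := by simp
      rw [this, ← MvPolynomial.C_mul, mul_inv_cancel₀ hb, MvPolynomial.C_1])
    (genericBlock p n).charpoly_monic
    (by rw [Matrix.charpoly_natDegree_eq_dim, card_block_index, hN'])
  refine ⟨C (MvPolynomial.C ((-1) ^ (2 ^ p * n))) * Q, fun M => ?_⟩
  set ev := MvPolynomial.eval fun s => (M : ClMatrix p n) s
  obtain ⟨A, hA, hAP⟩ := exists_charpoly_block_eq_pow h M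
  have hAN : A.natDegree = N :=
    Nat.eq_of_mul_eq_mul_left (Nat.succ_pos b) ((hdeg M A hAP).trans hN'.symm)
  have hAQ : A = Q.map ev := by
    refine eq_of_pow_sub_pow_small hb hA (hQ.map ev) hAN (by rw [hQ.natDegree_map, hQN])
      fun m hm => ?_
    rw [← hAP, ← genericBlock_charpoly_map_eval, ← Polynomial.map_pow, ← Polynomial.map_sub,
      coeff_map, hQP m hm, map_zero]
  rw [detPoly_eq, hAP, hAQ, Polynomial.map_mul, map_C, mul_pow, ← C_pow]
  congr 2
  rw [MvPolynomial.eval_C, hsign]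

end PowerOfRoot

theorem mainTheorem1 (p n : ℕ) :
    -- carré du champ of the Euclidean Laplacian on `P(X)`, `P(Y)`
    (∀ (M : ClSymm p n) (x y : ℝ), x ≠ y →
      carreDuChamp (clLaplacian p n)
          (fun N => (detPoly N).eval x) (fun N => (detPoly N).eval y) M =
        2 ^ p / (y - x) *
          ((detPoly M).derivative.eval x * (detPoly M).eval y
            - (detPoly M).derivative.eval y * (detPoly M).eval x)) ∧
    -- the Laplacian on `P`, when `p = 4m + 2`
    (∀ m : ℕ, p = 4 * m + 2 → ∀ (M : ClSymm p n) (x : ℝ), (detPoly M).eval x ≠ 0 →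
      clLaplacian p n (fun N => (detPoly N).eval x) M / (detPoly M).eval x =
        carreDuChamp (clLaplacian p n)
            (fun N => Real.log ((detPoly N).eval x)) (fun N => Real.log ((detPoly N).eval x)) M
          - 2 ^ (2 * m) * (-1) ^ (m + 1) * (clResolvent M x ^ 2).trace
          - 1 / 2 * (clResolvent M x).trace ^ 2 ∧
      clLaplacian p n (fun N => (detPoly N).eval x) M / (detPoly M).eval x =
        (2 ^ p + 2 ^ (2 * m) * (-1) ^ m) *
            ((detPoly M).derivative.eval x ^ 2 / (detPoly M).eval x ^ 2
              - (detPoly M).derivative.derivative.eval x / (detPoly M).eval x)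
          - 1 / 2 * ((detPoly M).derivative.eval x ^ 2 / (detPoly M).eval x ^ 2)) ∧
    -- the Laplacian on `P`, when `p = 4m`
    (∀ m : ℕ, p = 4 * m → ∀ (M : ClSymm p n) (x : ℝ), (detPoly M).eval x ≠ 0 →
      clLaplacian p n (fun N => (detPoly N).eval x) M / (detPoly M).eval x =
        carreDuChamp (clLaplacian p n)
            (fun N => Real.log ((detPoly N).eval x)) (fun N => Real.log ((detPoly N).eval x)) M
          - (2 : ℝ) ^ (2 * (m : ℤ) - 1) * (-1) ^ m * (clResolvent M x ^ 2).trace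
          - 1 / 2 * (clResolvent M x).trace ^ 2 ∧
      clLaplacian p n (fun N => (detPoly N).eval x) M / (detPoly M).eval x =
        (2 ^ p + (2 : ℝ) ^ (2 * (m : ℤ) - 1) * (-1) ^ (m + 1)) *
            ((detPoly M).derivative.eval x ^ 2 / (detPoly M).eval x ^ 2
              - (detPoly M).derivative.derivative.eval x / (detPoly M).eval x)
          - 1 / 2 * ((detPoly M).derivative.eval x ^ 2 / (detPoly M).eval x ^ 2)) ∧
    -- `P = Q ^ a`, and the action of `(a / 2 ^ p) L` on `Q`
    (∀ q a : ℕ,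
      (p = 8 * q ∧ a = 2 ^ (4 * q)) ∨ (p = 8 * q + 2 ∧ a = 2 ^ (4 * q + 2)) ∨
        (p = 8 * q + 4 ∧ a = 2 ^ (4 * q + 3)) ∨ (p = 8 * q + 6 ∧ a = 2 ^ (4 * q + 3)) →
      -- there is such a `Q`, whose coefficients are polynomials in the entries of `M`
      (∃ Q : (MvPolynomial (Finset (Fin p) × Fin n × Fin n) ℝ)[X], ∀ M : ClSymm p n,
        detPoly M = Q.map (MvPolynomial.eval fun s => (M : ClMatrix p n) s) ^ a) ∧
      -- and every such `Q` with twice continuously differentiable coefficients satisfies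
      (∀ Q : ClSymm p n → ℝ[X], (∀ k : ℕ, ContDiff ℝ 2 fun M => (Q M).coeff k) →
        (∀ M, detPoly M = Q M ^ a) →
        (∀ (M : ClSymm p n) (x y : ℝ), x ≠ y →
          carreDuChamp (fun f N => (a : ℝ) / 2 ^ p * clLaplacian p n f N)
              (fun N => (Q N).eval x) (fun N => (Q N).eval y) M =
            1 / (y - x) *
              ((Q M).derivative.eval x * (Q M).eval y
                - (Q M).derivative.eval y * (Q M).eval x)) ∧
        (p = 8 * q ∨ p = 8 * q + 6 → ∀ (M : ClSymm p n) (x : ℝ),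
          (a : ℝ) / 2 ^ p * clLaplacian p n (fun N => (Q N).eval x) M =
            -(1 / 2) * (Q M).derivative.derivative.eval x) ∧
        (p = 8 * q + 2 ∨ p = 8 * q + 4 → ∀ (M : ClSymm p n) (x : ℝ),
          (a : ℝ) / 2 ^ p * clLaplacian p n (fun N => (Q N).eval x) M =
            -2 * (Q M).derivative.derivative.eval x))) := by
  have hs0 : ∀ m : ℕ, p = 4 * m → ∑ A : Finset (Fin p), clSign A A = (-4) ^ m := by
    rintro m rfl; exact sum_clSign_self_four_mul m
  have hs2 : ∀ m : ℕ, p = 4 * m + 2 → ∑ A : Finset (Fin p), clSign A A = -2 * (-4) ^ m := by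
    rintro m rfl; exact sum_clSign_self_four_mul_add_two m
  have h4 : ∀ m : ℕ, (-4 : ℝ) ^ m = 2 ^ (2 * m) * (-1) ^ m := fun m => by
    rw [pow_mul, ← mul_pow]; norm_num
  refine ⟨fun M x y hxy => carreDuChamp_detPoly M hxy, fun m hm M x hx => ?_,
    fun m hm M x hx => ?_, fun q a hqa => ⟨?_, fun Q hc hQ => ?_⟩⟩
  · have hp : Even p := ⟨2 * m + 1, by omega⟩
    obtain ⟨h1, h2⟩ := clLaplacian_detPoly_div hp M hx
    rw [hs2 m hm, h4] at h1 h2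
    refine ⟨h1.trans ?_, h2.trans ?_⟩ <;> ring
  · have hp : Even p := ⟨2 * m, by omega⟩
    have hz : (2 : ℝ) ^ (2 * (m : ℤ) - 1) = 2 ^ (2 * m) / 2 := by
      rw [zpow_sub_one₀ two_ne_zero, div_eq_mul_inv]
      norm_cast
    obtain ⟨h1, h2⟩ := clLaplacian_detPoly_div hp M hx
    rw [hs0 m hm, h4] at h1 h2
    rw [hz]
    refine ⟨h1.trans ?_, h2.trans ?_⟩ <;> ring
  · have ha : a ≠ 0 := by rcases hqa with h | h | h | h <;> rw [h.2] <;> positivity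
    obtain ⟨b, rfl⟩ := Nat.exists_eq_succ_of_ne_zero ha
    refine exists_generic_root (cliffordDvd_of_even hqa) ?_
    -- for `p = 0` the exponent is `1`, and otherwise the sign is `1`
    rcases Nat.eq_zero_or_pos p with rfl | hp
    · have hb : b + 1 = 1 := by
        rcases hqa with h | h | h | h
        · have : q = 0 := by omega
          rw [← Nat.succ_eq_add_one, h.2, this]; rfl
        all_goals omega
      rw [hb, pow_one]
    · have he : Even (2 ^ p * n) := ((Nat.even_pow.2 ⟨even_two, hp.ne'⟩)).mul_right n
      rw [he.neg_one_pow, one_pow]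
  · have ha : a ≠ 0 := by rcases hqa with h | h | h | h <;> rw [h.2] <;> positivity
    have hp : Even p := by
      rw [Nat.even_iff]; omega
    obtain ⟨b, hb⟩ := Nat.exists_eq_succ_of_ne_zero ha
    subst hb
    have hcast : ((b + 1 : ℕ) : ℝ) = b + 1 := by push_cast; rfl
    refine ⟨fun M x y hxy => carreDuChamp_root hc hQ M hxy, fun hreal M x => ?_,
      fun hquat M x => ?_⟩
    · -- here `a = ∑_A (A|A)` and `a² = 2 ^ p`
      have hsq : (b + 1 : ℝ) ^ 2 = 2 ^ p ∧ ∑ A : Finset (Fin p), clSign A A = b + 1 := by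
        rw [← hcast]
        rcases hqa with ⟨h, h'⟩ | ⟨h, h'⟩ | ⟨h, h'⟩ | ⟨h, h'⟩
        · rw [hs0 (2 * q) (by omega), h4, h, ← Nat.succ_eq_add_one, h']
          push_cast
          refine ⟨by ring, ?_⟩
          rw [pow_mul (-1 : ℝ) 2 q]; norm_num; ring
        · omega
        · omega
        · rw [hs2 (2 * q + 1) (by omega), h4, h, ← Nat.succ_eq_add_one, h']
          push_cast
          refine ⟨by ring, ?_⟩
          rw [pow_succ (-1 : ℝ) (2 * q), pow_mul (-1 : ℝ) 2 q]; norm_num; ring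
      rw [clLaplacian_root hp hc hQ (by rw [hsq.2]; linear_combination 2 * hsq.1) M x]
      have : (2 : ℝ) ^ p ≠ 0 := by positivity
      push_cast
      field_simp
      linear_combination (-(Q M).derivative.derivative.eval x) * hsq.1
    · -- here `∑_A (A|A) = -a / 2` and `a² = 4 * 2 ^ p`
      have hsq : (b + 1 : ℝ) ^ 2 = 4 * 2 ^ p ∧
          ∑ A : Finset (Fin p), clSign A A = -((b + 1) / 2) := by
        rw [← hcast]
        rcases hqa with ⟨h, h'⟩ | ⟨h, h'⟩ | ⟨h, h'⟩ | ⟨h, h'⟩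
        · omega
        · rw [hs2 (2 * q) (by omega), h4, h, ← Nat.succ_eq_add_one, h']
          push_cast
          refine ⟨by ring, ?_⟩
          rw [pow_mul (-1 : ℝ) 2 q]; norm_num; ring
        · rw [hs0 (2 * q + 1) (by omega), h4, h, ← Nat.succ_eq_add_one, h']
          push_cast
          refine ⟨by ring, ?_⟩
          rw [pow_succ (-1 : ℝ) (2 * q), pow_mul (-1 : ℝ) 2 q]; norm_num; ring
        · omega
      rw [clLaplacian_root hp hc hQ (by rw [hsq.2]; linear_combination (1 / 2) * hsq.1) M x]
      have : (2 : ℝ) ^ p ≠ 0 := by positivity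
      push_cast
      field_simp
      linear_combination (-(Q M).derivative.derivative.eval x) * hsq.1
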